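/- Consider equations $Q(u_{00},u_{10},u_{01},u_{11})=0$ on the vertices of a square, where $u_{ij}$ stands for the value $u_{n+i,m+j}$ of an unknown complex function on the lattice and $Q$ is a polynomial with constant complex coefficients, of degree at most one in each of its four variables. Such an equation is called linearizable by a point transformation $\tilde u=f(u)$ if $f$ is holomorphic with nowhere vanishing derivative on a connected open set $D\subset\mathbb C$ and there are constants $a,b,c,d,e\in\mathbb C$ with $(a,b,c,d)\neq 0$ and a point $p\in D^4$ with $Q(p)=0$ and $\partial Q/\partial u_{ij}(p)\ne0$ for all $i,j\in\{0,1\}$, such that every solution $u$ of $Q=0$ in a neighbourhood of $p$ satisfies the linear equation $a\tilde u_{00}+b\tilde u_{10}+c\tilde u_{01}+d\tilde u_{11}+e=0$ with $\tilde u_{ij}=f(u_{ij})$. Two equations $Q=0$ and $P=0$ are called equivalent if, up to a nonzero constant factor, $P$ is obtained from $Q$ by a Möbius transformation $u_{ij}=(b_1v_{ij}+b_2)/(b_3v_{ij}+b_4)$, $b_1b_4-b_2b_3\neq0$, of the dependent variable (clearing denominators), possibly composed with the exchange $n\leftrightarrow m$ (that is, $u_{10}\leftrightarrow u_{01}$).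 (1) Such an equation is linearizable by a Möbius transformation $f$ if and only if it is equivalent to an equation $$w_{01}w_{11}(w_{10}+\beta w_{00})+w_{00}w_{10}(\gamma w_{11}+\delta w_{01})+\epsilon\, w_{00}w_{10}w_{01}w_{11}=0,\qquad \epsilon\in\{0,1\},\ \beta,\gamma,\delta\in\mathbb C\setminus\{0\}.$$ The inversion $\tilde u=1/w$ linearizes the latter to $\tilde u_{00}+\beta\tilde u_{10}+\gamma\tilde u_{01}+\delta\tilde u_{11}+\epsilon=0$. (2) Such an equation is linearizable, but not by a Möbius transformation, if and only if it is equivalent to one of the following six equations, where $\theta\in\mathbb C\setminus\{0\}$ is an arbitrary parameter: $$\begin{aligned} &\text{(i)}\ w_{00}w_{10}w_{01}w_{11}=1, &&\text{(ii)}\ w_{00}=w_{10}w_{01}w_{11}, &&\text{(iii)}\ w_{10}=w_{00}w_{01}w_{11},\\ &\text{(iv)}\ w_{11}=w_{00}w_{10}w_{01}, &&\text{(v)}\ w_{01}w_{11}=\theta w_{00}w_{10}, &&\text{(vi)}\ w_{00}w_{11}=\theta w_{10}w_{01}. \end{aligned}$$ The transformation $\tilde u=\log w$ (principal branch) linearizes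 these, respectively, to $$\begin{aligned} &\text{(i)}\ \tilde u_{00}+\tilde u_{10}+\tilde u_{01}+\tilde u_{11}=2\pi i z, &&\text{(ii)}\ -\tilde u_{00}+\tilde u_{10}+\tilde u_{01}+\tilde u_{11}=2\pi i z,\\ &\text{(iii)}\ \tilde u_{00}-\tilde u_{10}+\tilde u_{01}+\tilde u_{11}=2\pi i z, &&\text{(iv)}\ -\tilde u_{00}-\tilde u_{10}-\tilde u_{01}+\tilde u_{11}=2\pi i z,\\ &\text{(v)}\ -\tilde u_{00}-\tilde u_{10}+\tilde u_{01}+\tilde u_{11}=\log\theta+2\pi i z, &&\text{(vi)}\ \tilde u_{00}-\tilde u_{10}-\tilde u_{01}+\tilde u_{11}=\log\theta+2\pi i z, \end{aligned}$$ with $z\in\mathbb Z$: nonzero values $w_{ij}$ satisfy the equation if and only if their logarithms satisfy the linear equation for some integer $z$, and near each solution with no $w_{ij}$ in $(-\infty,0]$ the linear equation holds with a fixed $z$. Likewise, nonzero $w_{ij}$ satisfy the equation in (1) if and only if their inverses satisfy its linear equation, and the inversion is linearizing near each such solution. -/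

import Mathlib

open Topology

/-- The vertices of the elementary square: `(i, j)` is the lattice point `(n + i, m + j)`. -/
abbrev Vertex : Type := Fin 2 × Fin 2

/-- The left-hand side of an autonomous equation on the square: a function of the four values
`u (0,0)`, `u (1,0)`, `u (0,1)`, `u (1,1)`. -/
abbrev QuadFun : Type := (Vertex → ℂ) → ℂ

/-- `Q` is a complex polynomial of degree at most one in each of the four variables
(sixteen arbitrary coefficients, one for each set of vertices). -/
def IsMultilinear (Q : QuadFun) : Prop :=
  ∃ a : Finset Vertex → ℂ, ∀ u : Vertex → ℂ, Q u = ∑ S : Finset Vertex, a S * ∏ i ∈ S, u i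

/-- The left-hand side `a u₀₀ + b u₁₀ + c u₀₁ + d u₁₁ + e` of a linear autonomous equation. -/
def linearForm (a b c d e : ℂ) : QuadFun := fun u =>
  a * u (0, 0) + b * u (1, 0) + c * u (0, 1) + d * u (1, 1) + e

/-- The partial derivative of `Q` with respect to the variable at the vertex `i`. -/
noncomputable def partialDeriv (Q : QuadFun) (i : Vertex) (u : Vertex → ℂ) : ℂ :=
  deriv (fun t : ℂ => Q (Function.update u i t)) (u i)

/-- The point transformation `ũ = f(u)`, with `f` holomorphic and `f' ≠ 0` on the connected open
set `D`, maps the equation `Q = 0` near the point `p` to the linear autonomous equation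
`a ũ₀₀ + b ũ₁₀ + c ũ₀₁ + d ũ₁₁ + e = 0`. Here `p` is a point of `Q = 0` with coordinates in `D` at
which all four partial derivatives of `Q` are nonzero: near `p` the equation can be solved for
each of its four variables, and any three of them are independent. -/
structure LinearizesNear (Q : QuadFun) (f : ℂ → ℂ) (D : Set ℂ) (a b c d e : ℂ)
    (p : Vertex → ℂ) : Prop where
  isOpen : IsOpen D
  isConnected : IsConnected D
  differentiableOn : DifferentiableOn ℂ f D
  deriv_ne_zero : ∀ x ∈ D, deriv f x ≠ 0
  coeff_ne_zero : a ≠ 0 ∨ b ≠ 0 ∨ c ≠ 0 ∨ d ≠ 0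
  mem : ∀ i, p i ∈ D
  solution : Q p = 0
  regular : ∀ i, partialDeriv Q i p ≠ 0
  linear : ∀ᶠ u in 𝓝 p, Q u = 0 → linearForm a b c d e (fun i => f (u i)) = 0

/-- `Q = 0` is linearizable by an autonomous point transformation. -/
def Linearizable (Q : QuadFun) : Prop :=
  ∃ (f : ℂ → ℂ) (D : Set ℂ) (a b c d e : ℂ) (p : Vertex → ℂ), LinearizesNear Q f D a b c d e p

/-- `Q = 0` is linearizable by a point transformation that is a Möbius transformation. -/
def LinearizableByMobius (Q : QuadFun) : Prop :=
  ∃ c₁ c₂ c₃ c₄ : ℂ, c₁ * c₄ - c₂ * c₃ ≠ 0 ∧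
    ∃ (D : Set ℂ) (a b c d e : ℂ) (p : Vertex → ℂ), (∀ x ∈ D, c₃ * x + c₄ ≠ 0) ∧
      LinearizesNear Q (fun x => (c₁ * x + c₂) / (c₃ * x + c₄)) D a b c d e p

/-- The equation `P = 0` in the unknown `v` is obtained from the equation `Q = 0` in the unknown
`u` by a Möbius transformation `u = (b₁ v + b₂) / (b₃ v + b₄)` of the dependent variable, possibly
composed with the exchange of the two independent variables (clearing denominators, and up to a
nonzero constant factor). -/
def MobiusEquiv (Q P : QuadFun) : Prop :=
  ∃ b₁ b₂ b₃ b₄ k : ℂ, b₁ * b₄ - b₂ * b₃ ≠ 0 ∧ k ≠ 0 ∧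
    ∃ σ : Vertex → Vertex, (σ = id ∨ σ = Prod.swap) ∧
      ∀ v : Vertex → ℂ, (∀ i, b₃ * v i + b₄ ≠ 0) →
        P v = k * (∏ i, (b₃ * v i + b₄)) *
          Q (fun i => (b₁ * v (σ i) + b₂) / (b₃ * v (σ i) + b₄))

/-- The class linearized by the inversion. -/
def inversionForm (β γ δ ε : ℂ) : QuadFun := fun w =>
  w (0, 1) * w (1, 1) * (w (1, 0) + β * w (0, 0))
    + w (0, 0) * w (1, 0) * (γ * w (1, 1) + δ * w (0, 1))
    + ε * w (0, 0) * w (1, 0) * w (0, 1) * w (1, 1)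

def logForm1 : QuadFun := fun w => w (0, 0) * w (1, 0) * w (0, 1) * w (1, 1) - 1

def logForm2 : QuadFun := fun w => w (0, 0) - w (1, 0) * w (0, 1) * w (1, 1)

def logForm3 : QuadFun := fun w => w (1, 0) - w (0, 0) * w (0, 1) * w (1, 1)

def logForm4 : QuadFun := fun w => w (1, 1) - w (0, 0) * w (1, 0) * w (0, 1)

def logForm5 (θ : ℂ) : QuadFun := fun w => w (0, 1) * w (1, 1) - θ * w (0, 0) * w (1, 0)

def logForm6 (θ : ℂ) : QuadFun := fun w => w (0, 0) * w (1, 1) - θ * w (1, 0) * w (0, 1)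

/-- The inversion `ũ = 1/w` turns `Q = 0` into `a ũ₀₀ + b ũ₁₀ + c ũ₀₁ + d ũ₁₁ + e = 0`: the two
equations are equivalent for nonzero values of `w`, and the inversion is a linearizing
point transformation near every solution with nonzero values (there are such solutions). -/
def LinearizedByInversion (Q : QuadFun) (a b c d e : ℂ) : Prop :=
  (∀ w : Vertex → ℂ, (∀ i, w i ≠ 0) →
    (Q w = 0 ↔ linearForm a b c d e (fun i => 1 / w i) = 0)) ∧
  (∃ p : Vertex → ℂ, (∀ i, p i ≠ 0) ∧ Q p = 0) ∧
  (∀ p : Vertex → ℂ, (∀ i, p i ≠ 0) → Q p = 0 →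
    LinearizesNear Q (fun x => 1 / x) {0}ᶜ a b c d e p)

/-- The principal logarithm `ũ = log w` turns `Q = 0` into the equations
`a ũ₀₀ + b ũ₁₀ + c ũ₀₁ + d ũ₁₁ = κ + 2πi z` with `z` an integer: for nonzero values of `w`, `Q = 0`
holds iff one of these equations does, and the logarithm is a linearizing point transformation
to one of them near every solution with values off the branch cut (there are such solutions). -/
def LinearizedByLog (Q : QuadFun) (a b c d κ : ℂ) : Prop :=
  (∀ w : Vertex → ℂ, (∀ i, w i ≠ 0) →
    (Q w = 0 ↔ ∃ z : ℤ,
      linearForm a b c d 0 (fun i => Complex.log (w i)) = κ + 2 * Real.pi * Complex.I * z)) ∧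
  (∃ p : Vertex → ℂ, (∀ i, p i ∈ Complex.slitPlane) ∧ Q p = 0) ∧
  (∀ p : Vertex → ℂ, (∀ i, p i ∈ Complex.slitPlane) → Q p = 0 → ∃ z : ℤ,
    LinearizesNear Q Complex.log Complex.slitPlane a b c d
      (-(κ + 2 * Real.pi * Complex.I * z)) p)

/-! Suppose `∑ α i * f (u i) + e = 0` on the hypersurface `Q = 0` near a regular point. The
gradients of the two functions are then proportional there: `Q_i α_j f'(u_j) = Q_j α_i f'(u_i)`
(`LinearizesNear.gradient`), which also forces every `α i` to be nonzero. For distinct vertices `i`,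
`l`, `k` the discriminant of `Q` in `(u_l, u_k)` equals `Q_l Q_k` on `Q = 0`; it does not involve
`u_l`, `u_k` and is at most quadratic in `u_i`. Vary `u_i`, solve for `u_k` and freeze the other two
variables: the gradient relation turns (discriminant) `* f'(u_i)` into the discriminant in `(u_i,
u_k)` times a constant, and this is constant. So `f'` is a constant over a quadratic polynomial
(`LinearizesNear.exists_quadratic`).

If the quadratic has a double root, possibly at infinity, then `f` is Möbius. In the coordinate `f`
the linear form itself vanishes on the hypersurface. A multilinear function vanishing near a regular
zero of `Q` on `Q = 0` is a multiple of `Q` (`IsMultilinear.eq_const_mul_of_zero`), so the equation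
is linear in that coordinate, and inversion with a scaling gives the normal form of part (1).

If the roots are distinct, a Möbius map sends them to zero and infinity, so `x * f'(x)` is constant:
`f` is locally a multiple of a logarithm. The gradient relation becomes `α_j u_i Q_i = α_i u_j Q_j`
on `Q = 0`. Since `u_i Q_i = -Q|_{u_i = 0}` there, this is again a multilinear identity on `Q = 0`,
hence a polynomial identity modulo a multiple of `Q`. Comparing coefficients shows that two
monomials of `Q` must be complementary (`LinearizesNear.eq_binomialForm`), and scaling and exchange
reduce the resulting binomials to the six equations.

Conversely, both kinds of linearizability are invariant under equivalence and the normal forms are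
linearized explicitly. The log forms are not linearizable by a Möbius map, because their
discriminant has a simple zero while the derivative of a Möbius map is a constant over a square. -/

/-! ### Multilinear functions of the four vertex values -/

/-- The coefficient of `u i` in a multilinear `Q`, as a function of the other variables. -/
def vslope (Q : QuadFun) (i : Vertex) (u : Vertex → ℂ) : ℂ :=
  Q (Function.update u i 1) - Q (Function.update u i 0)

/-- Solve the multilinear equation `Q = 0` for the variable at the vertex `k`. -/
noncomputable def solve (Q : QuadFun) (k : Vertex) (u : Vertex → ℂ) : Vertex → ℂ :=
  Function.update u k (-Q (Function.update u k 0) / vslope Q k u)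

/-- The discriminant of `Q`, seen as a bilinear function of the variables at `l` and `k`. -/
def bidisc (Q : QuadFun) (l k : Vertex) (u : Vertex → ℂ) : ℂ :=
  Q (Function.update (Function.update u l 1) k 0) * Q (Function.update (Function.update u l 0) k 1)
    - Q (Function.update (Function.update u l 0) k 0) *
      Q (Function.update (Function.update u l 1) k 1)

namespace IsMultilinear

variable {Q R : QuadFun}

theorem sum {ι : Type*} (s : Finset ι) {F : ι → QuadFun} (h : ∀ j ∈ s, IsMultilinear (F j)) :
    IsMultilinear (fun u => ∑ j ∈ s, F j u) := by
  classical
  choose! a ha using h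
  refine ⟨fun S => ∑ j ∈ s, a j S, fun u => ?_⟩
  simp only [Finset.sum_mul]
  rw [Finset.sum_congr rfl fun j hj => ha j hj u, Finset.sum_comm]

theorem const_mul (h : IsMultilinear Q) (c : ℂ) : IsMultilinear (fun u => c * Q u) := by
  obtain ⟨a, ha⟩ := h
  exact ⟨fun S => c * a S, fun u => by simp [ha, Finset.mul_sum, mul_assoc]⟩

theorem add (hQ : IsMultilinear Q) (hR : IsMultilinear R) : IsMultilinear (fun u => Q u + R u) := by
  obtain ⟨a, ha⟩ := hQ
  obtain ⟨b, hb⟩ := hR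
  exact ⟨fun S => a S + b S, fun u => by simp [ha, hb, add_mul, Finset.sum_add_distrib]⟩

theorem sub (hQ : IsMultilinear Q) (hR : IsMultilinear R) : IsMultilinear (fun u => Q u - R u) := by
  obtain ⟨a, ha⟩ := hQ
  obtain ⟨b, hb⟩ := hR
  exact ⟨fun S => a S - b S, fun u => by simp [ha, hb, sub_mul, Finset.sum_sub_distrib]⟩

theorem prod_affine (α β : Vertex → ℂ) : IsMultilinear (fun u => ∏ i, (α i * u i + β i)) := by
  refine ⟨fun S => (∏ i ∈ S, α i) * ∏ i ∈ Finset.univ \ S, β i, fun u => ?_⟩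
  simp only []
  rw [Finset.prod_add, Finset.powerset_univ]
  refine Finset.sum_congr rfl fun S _ => ?_
  rw [Finset.prod_mul_distrib]
  ring

theorem monomial (S : Finset Vertex) : IsMultilinear (fun u => ∏ i ∈ S, u i) :=
  ⟨fun T => if T = S then 1 else 0, fun u => by simp⟩

theorem const (c : ℂ) : IsMultilinear (fun _ => c) := by
  simpa using (monomial ∅).const_mul c

theorem coord (i : Vertex) : IsMultilinear (fun u => u i) := by
  simpa using monomial {i}

theorem continuous (h : IsMultilinear Q) : Continuous Q := by
  obtain ⟨a, ha⟩ := h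
  rw [show Q = _ from funext ha]
  fun_prop

theorem update_eq (h : IsMultilinear Q) (i : Vertex) (u : Vertex → ℂ) (t : ℂ) :
    Q (Function.update u i t) = Q (Function.update u i 0) + t * vslope Q i u := by
  obtain ⟨a, ha⟩ := h
  simp only [vslope, ha]
  rw [← Finset.sum_sub_distrib, Finset.mul_sum, ← Finset.sum_add_distrib]
  refine Finset.sum_congr rfl fun S _ => ?_
  by_cases hi : i ∈ S
  · simp only [Finset.prod_update_of_mem hi]
    ring
  · simp only [Finset.prod_update_of_notMem hi]
    ring

/-- Clearing denominators keeps multilinearity: in the monomial of `S`, a vertex of `S` contributes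
the numerator of its Möbius value and every other vertex the denominator, so each variable enters
through one affine factor. -/
theorem comp_affine (h : IsMultilinear Q) (α β γ δ : ℂ) (σ : Vertex → Vertex)
    (hσ : Function.Bijective σ) :
    ∃ P, IsMultilinear P ∧ ∀ v : Vertex → ℂ, (∀ i, γ * v i + δ ≠ 0) →
      P v = (∏ i, (γ * v i + δ)) * Q (fun i => (α * v (σ i) + β) / (γ * v (σ i) + δ)) := by
  obtain ⟨a, ha⟩ := h
  set e := Equiv.ofBijective σ hσ
  refine ⟨fun v => ∑ S, a S *
    ∏ i, ((if e.symm i ∈ S then α else γ) * v i + if e.symm i ∈ S then β else δ), ?_, ?_⟩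
  · exact sum _ fun S _ => (prod_affine _ _).const_mul _
  · intro v hv
    rw [ha, Finset.mul_sum]
    refine Finset.sum_congr rfl fun S _ => ?_
    rw [mul_left_comm]
    congr 1
    have hS : ∏ i ∈ S, (α * v (σ i) + β) / (γ * v (σ i) + δ) =
        ∏ i, if i ∈ S then (α * v (σ i) + β) / (γ * v (σ i) + δ) else 1 := by
      rw [Finset.prod_ite_mem, Finset.univ_inter]
    rw [hS, ← e.prod_comp, ← e.prod_comp (fun i => γ * v i + δ), ← Finset.prod_mul_distrib]
    refine Finset.prod_congr rfl fun i _ => ?_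
    have : γ * v (σ i) + δ ≠ 0 := hv _
    have he : e i = σ i := rfl
    have he' : e.symm (σ i) = i := e.symm_apply_apply i
    by_cases hi : i ∈ S
    · simp only [he, he', hi, if_true]
      exact (mul_div_cancel₀ _ this).symm
    · simp [hi, he, he']

theorem translate (h : IsMultilinear Q) (p : Vertex → ℂ) :
    IsMultilinear (fun v => Q (fun i => v i + p i)) := by
  obtain ⟨a, ha⟩ := h
  simp only [ha]
  refine sum _ fun S _ => const_mul ?_ _
  have := prod_affine (fun i => if i ∈ S then 1 else 0) (fun i => if i ∈ S then p i else 1)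
  convert this using 2 with v
  rw [← Finset.prod_subset S.subset_univ (fun i _ hi => by simp [hi])]
  exact Finset.prod_congr rfl fun i hi => by simp [hi]

/-- Points all of whose coordinates avoid a finite set are dense. Identities of multilinear
functions may therefore be checked away from poles. -/
theorem eq_of_eq_off_finite (hQ : IsMultilinear Q) (hR : IsMultilinear R) (N : Set ℂ)
    (hN : N.Finite) (h : ∀ v : Vertex → ℂ, (∀ i, v i ∉ N) → Q v = R v) : Q = R := by
  have hd : Dense (Set.univ.pi fun _ : Vertex => Nᶜ) :=
    dense_pi _ fun _ _ => hN.countable.dense_compl ℂ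
  exact hQ.continuous.ext_on hd hR.continuous fun v hv => h v fun i => hv i (Set.mem_univ i)

theorem coeff_eq_zero {a : Finset Vertex → ℂ} (h : ∀ u : Vertex → ℂ, ∑ S, a S * ∏ i ∈ S, u i = 0)
    (S : Finset Vertex) : a S = 0 := by
  induction S using Finset.strongInduction with
  | H S ih =>
    have := h fun i => if i ∈ S then 1 else 0
    rw [Finset.sum_eq_single S] at this
    · rwa [Finset.prod_congr rfl fun i hi => if_pos hi, Finset.prod_const_one, mul_one] at this
    · intro T _ hT
      by_cases hTS : T ⊆ S
      · simp [ih T (hTS.ssubset_of_ne hT)]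
      · obtain ⟨i, hi, hiS⟩ := Finset.not_subset.1 hTS
        rw [Finset.prod_eq_zero hi (by simp [hiS]), mul_zero]
    · simp

theorem eq_slope (h : IsMultilinear Q) (i : Vertex) (u : Vertex → ℂ) :
    Q u = Q (Function.update u i 0) + u i * vslope Q i u := by
  rw [← h.update_eq, Function.update_eq_self]

theorem update_of_zero (h : IsMultilinear Q) {u : Vertex → ℂ} (hu : Q u = 0) (i : Vertex) (t : ℂ) :
    Q (Function.update u i t) = (t - u i) * vslope Q i u := by
  rw [h.eq_slope i] at hu
  rw [h.update_eq]
  linear_combination hu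

theorem hasDerivAt_update (h : IsMultilinear Q) (i : Vertex) (u : Vertex → ℂ) (t : ℂ) :
    HasDerivAt (fun t => Q (Function.update u i t)) (vslope Q i u) t := by
  rw [show (fun t => Q (Function.update u i t)) = _ from funext (h.update_eq i u)]
  exact (hasDerivAt_mul_const (vslope Q i u)).const_add _

theorem partialDeriv_eq (h : IsMultilinear Q) (i : Vertex) (u : Vertex → ℂ) :
    partialDeriv Q i u = vslope Q i u :=
  (h.hasDerivAt_update i u _).deriv

theorem continuous_slope (h : IsMultilinear Q) (i : Vertex) : Continuous (vslope Q i) :=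
  (h.continuous.comp (continuous_id.update i continuous_const)).sub
    (h.continuous.comp (continuous_id.update i continuous_const))

theorem solve_eq_zero (h : IsMultilinear Q) {k : Vertex} {u : Vertex → ℂ} (hk : vslope Q k u ≠ 0) :
    Q (solve Q k u) = 0 := by
  rw [solve, h.update_eq, div_mul_cancel₀ _ hk, add_neg_cancel]

theorem solve_eq_self (h : IsMultilinear Q) {k : Vertex} {u : Vertex → ℂ} (hk : vslope Q k u ≠ 0)
    (hu : Q u = 0) : solve Q k u = u := by
  rw [solve, Function.update_eq_iff]
  refine ⟨?_, fun _ _ => rfl⟩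
  rw [h.eq_slope k] at hu
  rw [div_eq_iff hk]
  linear_combination -hu

theorem continuousAt_solve (h : IsMultilinear Q) {k : Vertex} {u : Vertex → ℂ}
    (hk : vslope Q k u ≠ 0) : ContinuousAt (solve Q k) u := by
  refine continuousAt_id.update k (ContinuousAt.div ?_ (h.continuous_slope k).continuousAt hk)
  exact (h.continuous.comp (continuous_id.update k continuous_const)).neg.continuousAt

theorem tendsto_solve (h : IsMultilinear Q) {k : Vertex} {u : Vertex → ℂ}
    (hk : vslope Q k u ≠ 0) (hu : Q u = 0) : Filter.Tendsto (solve Q k) (𝓝 u) (𝓝 u) := by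
  simpa only [ContinuousAt, h.solve_eq_self hk hu] using h.continuousAt_solve hk

/-- For `q = a + b s + c t + d s t` one has `q_s q_t = (b c - a d) + d q`, and `b c - a d` is the
discriminant. -/
theorem bidisc_of_zero (h : IsMultilinear Q) {l k : Vertex} (hlk : l ≠ k) {u : Vertex → ℂ}
    (hu : Q u = 0) : bidisc Q l k u = vslope Q l u * vslope Q k u := by
  have key : ∀ s t, Q (Function.update (Function.update u l s) k t) =
      (1 - s) * ((1 - t) * Q (Function.update (Function.update u l 0) k 0)
        + t * Q (Function.update (Function.update u l 0) k 1))
      + s * ((1 - t) * Q (Function.update (Function.update u l 1) k 0)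
        + t * Q (Function.update (Function.update u l 1) k 1)) := by
    intro s t
    have h1 : ∀ s, Q (Function.update (Function.update u l s) k t) =
        (1 - t) * Q (Function.update (Function.update u l s) k 0) +
          t * Q (Function.update (Function.update u l s) k 1) := by
      intro s
      rw [h.update_eq k _ t, h.update_eq k _ 1]
      ring
    have h2 : ∀ t, Q (Function.update (Function.update u l s) k t) =
        (1 - s) * Q (Function.update (Function.update u l 0) k t) +
          s * Q (Function.update (Function.update u l 1) k t) := by
      intro t
      simp only [fun x => Function.update_comm hlk x t u]
      rw [h.update_eq l _ s, h.update_eq l _ 1]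
      ring
    rw [h1, h2, h2]
    ring
  have e0 : Q u = Q (Function.update (Function.update u l (u l)) k (u k)) := by simp
  have e1 : ∀ s, Q (Function.update u l s) =
      Q (Function.update (Function.update u l s) k (u k)) := by
    intro s
    rw [← Function.update_of_ne hlk.symm s u, Function.update_eq_self]
  have e2 : ∀ t, Q (Function.update u k t) =
      Q (Function.update (Function.update u l (u l)) k t) := by simp
  rw [e0, key] at hu
  simp only [vslope, bidisc, e1, e2]
  rw [key 1 (u k), key 0 (u k), key (u l) 1, key (u l) 0]
  linear_combination -(Q (Function.update (Function.update u l 0) k 0)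
    - Q (Function.update (Function.update u l 0) k 1)
    - Q (Function.update (Function.update u l 1) k 0)
    + Q (Function.update (Function.update u l 1) k 1)) * hu

theorem exists_quadratic_bidisc (h : IsMultilinear Q) (l k i : Vertex) (hil : i ≠ l) (hik : i ≠ k)
    (u : Vertex → ℂ) : ∃ A B C : ℂ, ∀ x,
      bidisc Q l k (Function.update u i x) = A * x ^ 2 + B * x + C := by
  have key : ∀ s t, ∃ a b, ∀ x, Q (Function.update (Function.update
      (Function.update u i x) l s) k t) = a + x * b := by
    intro s t
    refine ⟨Q (Function.update (Function.update (Function.update u l s) k t) i 0),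
      vslope Q i (Function.update (Function.update u l s) k t), fun x => ?_⟩
    rw [Function.update_comm hil, Function.update_comm hik, h.update_eq i]
  obtain ⟨a, b, h1⟩ := key 1 0
  obtain ⟨a', b', h2⟩ := key 0 1
  obtain ⟨c, d, h3⟩ := key 0 0
  obtain ⟨c', d', h4⟩ := key 1 1
  refine ⟨b * b' - d * d', a * b' + b * a' - c * d' - d * c', a * a' - c * c', fun x => ?_⟩
  rw [bidisc, h1, h2, h3, h4]
  ring

end IsMultilinear

theorem bidisc_update_left (Q : QuadFun) {l k : Vertex} (u : Vertex → ℂ) (t : ℂ) :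
    bidisc Q l k (Function.update u l t) = bidisc Q l k u := by
  simp [bidisc]

theorem bidisc_update_right (Q : QuadFun) {l k : Vertex} (hlk : l ≠ k) (u : Vertex → ℂ) (t : ℂ) :
    bidisc Q l k (Function.update u k t) = bidisc Q l k u := by
  simp only [bidisc]
  simp only [fun s => Function.update_comm hlk.symm t s u, Function.update_idem]

/-! ### Zeros near a regular zero, and divisibility by `Q`. -/

namespace IsMultilinear

variable {Q R : QuadFun}

/-- Near a regular zero `p` of `Q` there are zeros that differ from `p` only on a given set `S` of
at least two vertices, and whose values there avoid a given finite set. -/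
theorem frequently_zero_avoiding (h : IsMultilinear Q) {p : Vertex → ℂ} (hp : Q p = 0)
    (hreg : ∀ i, vslope Q i p ≠ 0) (S : Finset Vertex) {j k : Vertex} (hj : j ∈ S) (hk : k ∈ S)
    (hjk : j ≠ k) {N : Set ℂ} (hN : N.Finite) :
    ∃ᶠ u in 𝓝 p, Q u = 0 ∧ (∀ i ∉ S, u i = p i) ∧ ∀ i ∈ S, u i ∉ N := by
  rw [Filter.frequently_iff]
  intro U hU
  have hgood : ∀ᶠ w in 𝓝 p,
      solve Q k w ∈ U ∧ vslope Q k w ≠ 0 ∧ vslope Q j (solve Q k w) ≠ 0 := by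
    have ht := h.tendsto_solve (hreg k) hp
    refine (ht.eventually hU).and (((h.continuous_slope k).continuousAt.eventually_ne
      (hreg k)).and (ht.eventually ((h.continuous_slope j).continuousAt.eventually_ne (hreg j))))
  -- The coordinates in `S` other than `j`, `k` are shifted by a common small `t`; then `j` is moved
  -- freely and `k` is found by solving `Q = 0`. Each choice excludes only finitely many parameters.
  set c : ℂ → Vertex → ℂ := fun t i => if i ∈ S ∧ i ≠ j ∧ i ≠ k then t + p i else p i with hc
  have hc0 : c 0 = p := by
    ext i
    simp [hc]
  have hct : Filter.Tendsto c (𝓝 0) (𝓝 p) := by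
    have : Continuous c := by
      refine continuous_pi fun i => ?_
      simp only [hc]
      split_ifs <;> fun_prop
    simpa [hc0] using this.tendsto 0
  have hfin : ∀ i, ∀ᶠ t in 𝓝[≠] (0 : ℂ), t + p i ∉ N := fun i =>
    nhdsNE_le_cofinite _ (hN.preimage (add_left_injective (p i)).injOn).compl_mem_cofinite
  obtain ⟨t, ht, htN⟩ := (((hct.eventually hgood.eventually_nhds).filter_mono
    nhdsWithin_le_nhds).and (Filter.eventually_all.2 hfin)).exists
  set w := c t with hw
  have hcurve : Filter.Tendsto (fun x => Function.update w j x) (𝓝 (w j)) (𝓝 w) := by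
    have : Continuous (fun x : ℂ => Function.update w j x) := continuous_const.update j continuous_id
    simpa using this.tendsto (w j)
  have hwgood := ht.self_of_nhds
  -- For fixed `n` the condition that `n` solves for `u_k` is affine in `x = u_j`. It cannot hold
  -- identically: then `solve Q k w` would have the value `n` at `k` and zero slope in direction
  -- `j`, against the choice of `w`.
  have hbad : ∀ n ∈ N, {x : ℂ | Q (Function.update (Function.update w j x) k n) = 0}.Finite := by
    intro n _
    have e : ∀ x, Q (Function.update (Function.update w j x) k n) =
        Q (Function.update (Function.update w k n) j 0) +
          x * vslope Q j (Function.update w k n) := by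
      intro x
      rw [Function.update_comm hjk, h.update_eq j]
    simp only [e]
    by_cases hb : vslope Q j (Function.update w k n) = 0
    · simp only [hb, mul_zero, add_zero]
      have hne : Q (Function.update (Function.update w k n) j 0) ≠ 0 := by
        intro ha
        have h0 : Q (Function.update w k n) = 0 := by rw [h.eq_slope j, ha, hb]; simp
        have hs : solve Q k w = Function.update w k n := by
          rw [solve]
          congr 1
          rw [h.update_eq] at h0
          rw [div_eq_iff hwgood.2.1]
          linear_combination -h0
        exact hwgood.2.2 (hs ▸ hb)
      simp [hne]
    · refine (Set.finite_singleton (-Q (Function.update (Function.update w k n) j 0) /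
        vslope Q j (Function.update w k n))).subset fun x hx => ?_
      rw [Set.mem_singleton_iff, eq_div_iff hb]
      have hx' : _ + x * _ = (0 : ℂ) := hx
      linear_combination hx'
  have hfin2 : ∀ᶠ x in 𝓝[≠] (w j), x ∉ N ∧
      x ∉ ⋃ n ∈ N, {x : ℂ | Q (Function.update (Function.update w j x) k n) = 0} :=
    Filter.Eventually.and (nhdsNE_le_cofinite _ hN.compl_mem_cofinite)
      (nhdsNE_le_cofinite _ (hN.biUnion hbad).compl_mem_cofinite)
  obtain ⟨x, hx, hxN, hxB⟩ := (((hcurve.eventually ht).filter_mono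
    nhdsWithin_le_nhds).and hfin2).exists
  have hz : Q (solve Q k (Function.update w j x)) = 0 := h.solve_eq_zero hx.2.1
  refine ⟨_, hx.1, hz, fun i hi => ?_, fun i hi => ?_⟩
  · have h1 : i ≠ j := fun e => hi (e ▸ hj)
    have h2 : i ≠ k := fun e => hi (e ▸ hk)
    simp [solve, h1, h2, hw, hc, hi]
  · by_cases h2 : i = k
    · intro hm
      apply hxB
      simp only [Set.mem_iUnion]
      refine ⟨_, hm, ?_⟩
      subst h2
      rw [Set.mem_ofPred_eq, ← hz]
      congr 1
      simp [solve]
    · by_cases h1 : i = j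
      · subst h1
        simpa [solve, h2] using hxN
      · simpa [solve, h2, h1, hw, hc, hi] using htN i

/-- With the regular zero at the origin, subtract the multiple of `Q` that removes the linear
coefficient at one vertex `k`, and show that every coefficient of the difference `P` vanishes, by
induction on its set `S`. On zeros of `Q` supported on `S` with nonzero coordinates there, only the
monomial of `S` is left in `P`. Such zeros exist once `S` has two elements; the linear coefficients
need a separate limit argument. -/
theorem eq_const_mul_of_zero_aux (hQ : IsMultilinear Q) (hR : IsMultilinear R)
    (hp : Q 0 = 0) (hreg : ∀ i, vslope Q i 0 ≠ 0) (hv : ∀ᶠ u in 𝓝 0, Q u = 0 → R u = 0) :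
    ∃ c, ∀ u, R u = c * Q u := by
  set k : Vertex := (0, 0)
  set c := vslope R k 0 / vslope Q k 0 with hc
  have hR' : IsMultilinear (fun u => R u - c * Q u) := hR.sub (hQ.const_mul c)
  set P : QuadFun := fun u => R u - c * Q u with hP
  have hP0 : P 0 = 0 := by simp [hP, hp, hv.self_of_nhds hp]
  have hPk : vslope P k 0 = 0 := by
    have : vslope P k 0 = vslope R k 0 - c * vslope Q k 0 := by
      simp only [vslope, hP]
      ring
    rw [this, hc, div_mul_cancel₀ _ (hreg k), sub_self]
  have hPv : ∀ᶠ u in 𝓝 0, Q u = 0 → P u = 0 := by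
    filter_upwards [hv] with u hu h0
    simp [hP, hu h0, h0]
  have hP1 : ∀ i x, P (Function.update 0 i x) = x * vslope P i 0 := by
    intro i x
    rw [hR'.update_eq i, show Function.update (0 : Vertex → ℂ) i 0 = 0 by
      simp, hP0, zero_add]
  have hPs : ∀ i, vslope P i 0 = 0 := by
    intro i
    by_cases hik : i = k
    · rw [hik, hPk]
    · have hcont := (hR'.continuous_slope i).tendsto 0
      refine Set.mem_singleton_iff.1 (isClosed_singleton.mem_of_frequently_of_tendsto ?_ hcont)
      -- On zeros supported on `{i, k}`, `P` reduces to `u i * vslope P i u`, since `P` vanishes on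
      -- the `k`-axis. So the slope vanishes at points tending to the origin, hence at the origin.
      have := hQ.frequently_zero_avoiding hp hreg {i, k} (j := i) (k := k) (by simp) (by simp) hik
        (Set.finite_singleton 0)
      refine (this.and_eventually hPv).mono ?_
      rintro u ⟨⟨hu0, hus, hun⟩, huP⟩
      have h1 := huP hu0
      have h2 : Function.update u i 0 = Function.update (0 : Vertex → ℂ) k (u k) := by
        ext m
        by_cases hmi : m = i
        · subst hmi
          simp [hik]
        · by_cases hmk : m = k
          · subst hmk
            simp [hmi]
          · simpa [hmi, hmk] using hus m (by simp [hmi, hmk])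
      rw [hR'.eq_slope i, h2, hP1, hPk, mul_zero, zero_add] at h1
      exact (mul_eq_zero.1 h1).resolve_left (hun i (by simp))
  obtain ⟨r, hr⟩ := hR'
  have hsum : ∀ S, (∀ T, T ⊂ S → r T = 0) → ∀ u : Vertex → ℂ, (∀ i ∉ S, u i = 0) →
      P u = r S * ∏ i ∈ S, u i := by
    intro S ih u hu
    rw [show P u = _ from hr u, Finset.sum_eq_single S]
    · intro T _ hT
      by_cases hTS : T ⊆ S
      · simp [ih T (hTS.ssubset_of_ne hT)]
      · obtain ⟨i, hi, hiS⟩ := Finset.not_subset.1 hTS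
        rw [Finset.prod_eq_zero hi (hu i hiS), mul_zero]
    · simp
  have hr0 : ∀ S, r S = 0 := by
    intro S
    induction S using Finset.strongInduction with
    | H S ih =>
      rcases Nat.lt_or_ge 1 S.card with hS | hS
      · obtain ⟨i, hi, j, hj, hij⟩ := Finset.one_lt_card.1 hS
        have := hQ.frequently_zero_avoiding hp hreg S hi hj hij (Set.finite_singleton 0)
        obtain ⟨u, ⟨hu0, hus, hun⟩, huP⟩ := (this.and_eventually hPv).exists
        have h1 := huP hu0
        rw [hsum S ih u hus] at h1
        exact (mul_eq_zero.1 h1).resolve_right (Finset.prod_ne_zero_iff.2 fun i hi => hun i hi)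
      · rcases Finset.card_le_one_iff_subset_singleton.1 hS with ⟨i, hi⟩
        rcases Finset.subset_singleton_iff.1 hi with rfl | rfl
        · have := hsum ∅ ih 0 (by simp)
          simpa [hP0] using this.symm
        · have := hsum {i} ih (Function.update 0 i 1) (fun m hm => by
            simp only [Finset.mem_singleton] at hm
            simp [hm])
          rw [hP1, hPs] at this
          simpa using this.symm
  refine ⟨c, fun u => ?_⟩
  have := hr u
  simp only [hr0, zero_mul, Finset.sum_const_zero] at this
  linear_combination this

/-- A multilinear function that vanishes on the zeros of `Q` near a regular zero is a multiple
of `Q`. -/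
theorem eq_const_mul_of_zero (hQ : IsMultilinear Q) (hR : IsMultilinear R) {p : Vertex → ℂ}
    (hp : Q p = 0) (hreg : ∀ i, vslope Q i p ≠ 0) (hv : ∀ᶠ u in 𝓝 p, Q u = 0 → R u = 0) :
    ∃ c, ∀ u, R u = c * Q u := by
  have hslope : ∀ i, vslope (fun v => Q (fun m => v m + p m)) i 0 = vslope Q i p := by
    intro i
    have : ∀ s, (fun m => Function.update (0 : Vertex → ℂ) i s m + p m) =
        Function.update p i (s + p i) := by
      intro s
      ext m
      by_cases hm : m = i
      · subst hm
        simp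
      · simp [hm]
    simp only [vslope, this]
    rw [hQ.update_eq i p (1 + p i), hQ.update_eq i p (0 + p i), hQ.update_eq i p 1]
    ring
  have htend : Filter.Tendsto (fun v : Vertex → ℂ => (fun m => v m + p m)) (𝓝 0) (𝓝 p) := by
    have : Continuous (fun v : Vertex → ℂ => (fun m => v m + p m)) := by fun_prop
    simpa using this.tendsto 0
  obtain ⟨c, hc⟩ := eq_const_mul_of_zero_aux (hQ.translate p) (hR.translate p) (by simpa using hp)
    (fun i => by rw [hslope]; exact hreg i) (htend.eventually hv)
  refine ⟨c, fun u => ?_⟩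
  simpa using hc (fun m => u m - p m)

end IsMultilinear

/-! ### Punctured planar domains. -/

/-- Removing a point from a connected open subset of the plane leaves it connected. -/
theorem IsConnected.diff_singleton_of_isOpen {D : Set ℂ} (hD : IsConnected D) (ho : IsOpen D)
    (z : ℂ) : IsConnected (D \ {z}) := by
  by_cases hz : z ∈ D
  swap
  · rwa [Set.sdiff_singleton_eq_self hz]
  obtain ⟨r, hr, hball⟩ := Metric.isOpen_iff.1 ho z hz
  have hpunct : IsPreconnected (Metric.ball z r \ {z}) := by
    -- The punctured disc is the image of a half-plane under `w ↦ z + exp w`.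
    have himg : Metric.ball z r \ {z} = (fun w => z + Complex.exp w) '' {w | w.re < Real.log r} := by
      ext y
      simp only [Set.mem_sdiff, Metric.mem_ball, Set.mem_singleton_iff, Set.mem_image,
        Set.mem_ofPred_eq, dist_eq_norm]
      constructor
      · rintro ⟨h1, h2⟩
        have h3 : y - z ≠ 0 := sub_ne_zero.2 h2
        refine ⟨Complex.log (y - z), ?_, by rw [Complex.exp_log h3]; ring⟩
        rw [Complex.log_re]
        exact Real.log_lt_log (norm_pos_iff.2 h3) h1
      · rintro ⟨w, hw, rfl⟩
        refine ⟨?_, by simp [Complex.exp_ne_zero]⟩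
        rw [add_sub_cancel_left, Complex.norm_exp]
        exact (Real.lt_log_iff_exp_lt hr).1 hw
    rw [himg]
    refine IsPreconnected.image ?_ _ (by fun_prop)
    exact (convex_halfSpace_re_lt _).isPreconnected
  have hne : (Metric.ball z r \ {z}).Nonempty := by
    refine ⟨z + (r / 2 : ℝ), ?_, ?_⟩
    · rw [Metric.mem_ball, dist_eq_norm, add_sub_cancel_left, Complex.norm_real, Real.norm_eq_abs,
        abs_of_pos (by positivity)]
      linarith
    · simp only [Set.mem_singleton_iff, add_eq_left, Complex.ofReal_eq_zero]
      positivity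
  refine ⟨hne.mono (Set.sdiff_subset_sdiff_left hball), ?_⟩
  rw [isPreconnected_iff_subset_of_disjoint]
  -- If the punctured disc lies on one side of a separation of `D \ {z}`, adding the disc to that
  -- side separates `D` itself.
  have key : ∀ U V : Set ℂ, IsOpen U → IsOpen V → D \ {z} ⊆ U ∪ V → D \ {z} ∩ (U ∩ V) = ∅ →
      Metric.ball z r \ {z} ⊆ U → D \ {z} ⊆ U := by
    intro U V hU hV hcov hdisj hB
    have h1 : D ⊆ (U \ {z} ∪ Metric.ball z r) ∪ ((V ∩ D) \ {z}) := by
      intro x hx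
      by_cases hxz : x = z
      · exact Or.inl (Or.inr (hxz ▸ Metric.mem_ball_self hr))
      · rcases hcov ⟨hx, hxz⟩ with h | h
        · exact Or.inl (Or.inl ⟨h, hxz⟩)
        · exact Or.inr ⟨⟨h, hx⟩, hxz⟩
    have hoz : IsOpen ({z}ᶜ : Set ℂ) := isOpen_compl_singleton
    have h2 := (isPreconnected_iff_subset_of_disjoint.1 hD.isPreconnected) _ _
      ((hU.inter hoz).union Metric.isOpen_ball) ((hV.inter ho).inter hoz) h1 (by
        rw [Set.eq_empty_iff_forall_notMem] at hdisj ⊢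
        rintro x ⟨hx, h3 | h3, ⟨h4, h5⟩, h6⟩
        · exact hdisj x ⟨⟨hx, h6⟩, h3.1, h4⟩
        · exact hdisj x ⟨⟨hx, h6⟩, hB ⟨h3, h6⟩, h4⟩)
    rcases h2 with h2 | h2
    · rintro x ⟨hx, hxz⟩
      rcases h2 hx with h3 | h3
      · exact h3.1
      · exact hB ⟨h3, hxz⟩
    · exact absurd rfl (h2 hz).2
  intro U V hU hV hcov hdisj
  have hsub : Metric.ball z r \ {z} ⊆ D \ {z} := Set.sdiff_subset_sdiff_left hball
  rcases (isPreconnected_iff_subset_of_disjoint.1 hpunct) U V hU hV (hsub.trans hcov) (by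
    rw [Set.eq_empty_iff_forall_notMem] at hdisj ⊢
    exact fun x hx => hdisj x ⟨hsub hx.1, hx.2⟩) with h | h
  · exact Or.inl (key U V hU hV hcov hdisj h)
  · refine Or.inr (key V U hV hU (by rwa [Set.union_comm]) (by rwa [Set.inter_comm V]) h)

/-! ### Local consequences of a linearization: the gradient relation and the quadratic. -/

theorem linearForm_eq_sum (α : Vertex → ℂ) (e : ℂ) (u : Vertex → ℂ) :
    linearForm (α (0, 0)) (α (1, 0)) (α (0, 1)) (α (1, 1)) e u = ∑ i, α i * u i + e := by
  simp only [linearForm, Fintype.sum_prod_type, Fin.sum_univ_two]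
  ring

/-- The coefficients of a linear equation as a function on the vertices. -/
theorem exists_coeff (a b c d : ℂ) : ∃ α : Vertex → ℂ,
    α (0, 0) = a ∧ α (1, 0) = b ∧ α (0, 1) = c ∧ α (1, 1) = d :=
  ⟨fun i => !![a, c; b, d] i.1 i.2, by simp⟩

namespace LinearizesNear

variable {Q : QuadFun} {f : ℂ → ℂ} {D : Set ℂ} {α : Vertex → ℂ} {e : ℂ} {p : Vertex → ℂ}

theorem hasDerivAt {a b c d : ℂ} (h : LinearizesNear Q f D a b c d e p) {x : ℂ} (hx : x ∈ D) :
    HasDerivAt f (deriv f x) x :=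
  (h.differentiableOn.differentiableAt (h.isOpen.mem_nhds hx)).hasDerivAt

/-- All conditions on the base point except `Q = 0` are open, so relations proved at `p` hold at all
nearby zeros. -/
theorem eventually {a b c d : ℂ} (h : LinearizesNear Q f D a b c d e p) (hQ : IsMultilinear Q) :
    ∀ᶠ u in 𝓝 p, Q u = 0 → LinearizesNear Q f D a b c d e u := by
  have h1 : ∀ᶠ u in 𝓝 p, ∀ i, u i ∈ D := Filter.eventually_all.2 fun i =>
    (continuous_apply i).continuousAt.eventually (h.isOpen.mem_nhds (h.mem i))
  have h2 : ∀ᶠ u in 𝓝 p, ∀ i, partialDeriv Q i u ≠ 0 := by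
    refine Filter.eventually_all.2 fun i => ?_
    have := h.regular i
    simp only [hQ.partialDeriv_eq] at this ⊢
    exact (hQ.continuous_slope i).continuousAt.eventually_ne this
  filter_upwards [h1, h2, h.linear.eventually_nhds] with u hu1 hu2 hu3 hu0
  exact ⟨h.isOpen, h.isConnected, h.differentiableOn, h.deriv_ne_zero, h.coeff_ne_zero, hu1, hu0,
    hu2, hu3⟩

theorem congr {a b c d : ℂ} {g : ℂ → ℂ} (h : LinearizesNear Q f D a b c d e p)
    (hfg : Set.EqOn g f D) : LinearizesNear Q g D a b c d e p where
  isOpen := h.isOpen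
  isConnected := h.isConnected
  differentiableOn := h.differentiableOn.congr hfg
  deriv_ne_zero x hx := by
    rw [Filter.EventuallyEq.deriv_eq (Filter.eventuallyEq_of_mem (h.isOpen.mem_nhds hx) hfg)]
    exact h.deriv_ne_zero x hx
  coeff_ne_zero := h.coeff_ne_zero
  mem := h.mem
  solution := h.solution
  regular := h.regular
  linear := by
    have h1 : ∀ᶠ u in 𝓝 p, ∀ i, u i ∈ D := Filter.eventually_all.2 fun i =>
      (continuous_apply i).continuousAt.eventually (h.isOpen.mem_nhds (h.mem i))
    filter_upwards [h1, h.linear] with u hu1 hu2 hu0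
    rw [← hu2 hu0]
    congr 1
    ext i
    exact hfg (hu1 i)

theorem diff_singleton {a b c d : ℂ} (h : LinearizesNear Q f D a b c d e p) {z : ℂ}
    (hz : ∀ i, p i ≠ z) : LinearizesNear Q f (D \ {z}) a b c d e p where
  isOpen := h.isOpen.sdiff isClosed_singleton
  isConnected := h.isConnected.diff_singleton_of_isOpen h.isOpen z
  differentiableOn := h.differentiableOn.mono Set.sdiff_subset
  deriv_ne_zero x hx := h.deriv_ne_zero x hx.1
  coeff_ne_zero := h.coeff_ne_zero
  mem i := ⟨h.mem i, hz i⟩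
  solution := h.solution
  regular := h.regular
  linear := h.linear

theorem exists_avoiding {a b c d : ℂ} (h : LinearizesNear Q f D a b c d e p)
    (hQ : IsMultilinear Q) {N : Set ℂ} (hN : N.Finite) :
    ∃ u, LinearizesNear Q f D a b c d e u ∧ ∀ i, u i ∉ N := by
  have hf := hQ.frequently_zero_avoiding h.solution
    (fun i => by rw [← hQ.partialDeriv_eq]; exact h.regular i) Finset.univ
    (Finset.mem_univ (0, 0)) (Finset.mem_univ (1, 0)) (by decide) hN
  obtain ⟨u, ⟨h0, -, h1⟩, h2⟩ := (hf.and_eventually (h.eventually hQ)).exists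
  exact ⟨u, h2 h0, fun i => h1 i (Finset.mem_univ i)⟩

/-- Differentiate the linear relation along the curve in `Q = 0` on which `u_i = t`, `u_j` is solved
for and the other two variables are fixed. Implicit differentiation gives `u_j' = -Q_i / Q_j`. -/
theorem gradient (h : LinearizesNear Q f D (α (0, 0)) (α (1, 0)) (α (0, 1)) (α (1, 1)) e p)
    (hQ : IsMultilinear Q) {i j : Vertex} (hij : i ≠ j) :
    vslope Q i p * (α j * deriv f (p j)) = vslope Q j p * (α i * deriv f (p i)) := by
  have hj : vslope Q j p ≠ 0 := by rw [← hQ.partialDeriv_eq]; exact h.regular j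
  set c : ℂ → Vertex → ℂ := fun t => solve Q j (Function.update p i t) with hc
  have hs : HasDerivAt (fun t => c t j) (-vslope Q i p / vslope Q j p) (p i) := by
    have hN := hQ.hasDerivAt_update i (Function.update p j 0) (p i)
    have hD := (hQ.hasDerivAt_update i (Function.update p j 1) (p i)).sub hN
    have hD0 : Q (Function.update (Function.update p j 1) i (p i)) -
        Q (Function.update (Function.update p j 0) i (p i)) = vslope Q j p := by
      simp only [fun s => Function.update_comm hij.symm s (p i) p, Function.update_eq_self, vslope]
    have hq := hN.neg.div hD (by simpa [hD0] using hj)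
    have hfun : (fun t => c t j) = fun t => -Q (Function.update (Function.update p j 0) i t) /
        (Q (Function.update (Function.update p j 1) i t) -
          Q (Function.update (Function.update p j 0) i t)) := by
      ext t
      simp only [hc, solve, Function.update_self, vslope,
        fun s => Function.update_comm hij.symm s t p]
    rw [hfun]
    convert! hq using 1
    simp only [Pi.sub_apply, Pi.neg_apply, hD0]
    have e0 : Q (Function.update (Function.update p j 0) i (p i)) = -(p j) * vslope Q j p := by
      rw [Function.update_comm hij.symm, Function.update_eq_self, hQ.update_of_zero h.solution]
      ring
    have e1 : vslope Q i p = vslope Q i (Function.update p j 0) + p j *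
        (vslope Q i (Function.update p j 1) - vslope Q i (Function.update p j 0)) := by
      have : ∀ s, Q (Function.update p i s) = Q (Function.update (Function.update p j 0) i s)
          + p j * (Q (Function.update (Function.update p j 1) i s) -
            Q (Function.update (Function.update p j 0) i s)) := by
        intro s
        rw [hQ.eq_slope j (Function.update p i s), Function.update_of_ne hij.symm, vslope]
        simp only [fun t => Function.update_comm hij s t p]
      simp only [vslope, this]
      ring
    rw [e0, e1]
    field_simp
    ring
  have hc0 : c (p i) = p := by
    simp only [hc, Function.update_eq_self, hQ.solve_eq_self hj h.solution]
  have hupd : Filter.Tendsto (fun t : ℂ => Function.update p i t) (𝓝 (p i)) (𝓝 p) := by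
    have : Continuous (fun t : ℂ => Function.update p i t) :=
      continuous_const.update i continuous_id
    simpa using this.tendsto (p i)
  have hct : Filter.Tendsto c (𝓝 (p i)) (𝓝 p) := (hQ.tendsto_solve hj h.solution).comp hupd
  have hz : ∀ᶠ t in 𝓝 (p i), ∑ m, α m * f (c t m) + e = 0 := by
    filter_upwards [hct.eventually h.linear,
      hupd.eventually ((hQ.continuous_slope j).continuousAt.eventually_ne hj)] with t h1 h2
    rw [← linearForm_eq_sum α e fun m => f (c t m)]
    exact h1 (hQ.solve_eq_zero h2)
  have hd : ∀ m, HasDerivAt (fun t => α m * f (c t m))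
      (α m * (deriv f (p m) *
        (if m = j then -vslope Q i p / vslope Q j p else if m = i then 1 else 0))) (p i) := by
    intro m
    refine HasDerivAt.const_mul _ ?_
    have hm : HasDerivAt (fun t => c t m)
        (if m = j then -vslope Q i p / vslope Q j p else if m = i then 1 else 0) (p i) := by
      by_cases h1 : m = j
      · subst h1
        simpa using hs
      · by_cases h2 : m = i
        · subst h2
          simpa [hc, solve, h1] using hasDerivAt_id' (p m)
        · simpa [hc, solve, h1, h2] using hasDerivAt_const (p i) (p m)
    have hfd := h.hasDerivAt (h.mem m)
    rw [← congrFun hc0 m] at hfd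
    have := hfd.comp (p i) hm
    rwa [congrFun hc0 m] at this
  have hsum := (HasDerivAt.fun_sum (u := Finset.univ) fun m _ => hd m).add_const e
  have h0 : HasDerivAt (fun t => ∑ m, α m * f (c t m) + e) 0 (p i) :=
    (hasDerivAt_const (p i) (0 : ℂ)).congr_of_eventuallyEq hz
  have := hsum.unique h0
  rw [← Finset.sum_subset (Finset.subset_univ {i, j}) (by
    intro m _ hm
    simp only [Finset.mem_insert, Finset.mem_singleton, not_or] at hm
    simp [hm.1, hm.2]), Finset.sum_pair hij] at this
  simp only [hij, if_true, if_false] at this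
  field_simp at this
  linear_combination -this

theorem coeff_ne (h : LinearizesNear Q f D (α (0, 0)) (α (1, 0)) (α (0, 1)) (α (1, 1)) e p)
    (hQ : IsMultilinear Q) (i : Vertex) : α i ≠ 0 := by
  have hex : ∃ j, α j ≠ 0 := by
    rcases h.coeff_ne_zero with h | h | h | h <;> exact ⟨_, h⟩
  obtain ⟨j, hj⟩ := hex
  by_cases hij : i = j
  · rwa [hij]
  · intro h0
    have := h.gradient hQ hij
    have hi : vslope Q i p ≠ 0 := by rw [← hQ.partialDeriv_eq]; exact h.regular i
    rw [h0, zero_mul, mul_zero] at this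
    exact mul_ne_zero hi (mul_ne_zero hj (h.deriv_ne_zero _ (h.mem j))) this

/-- The derivative of a linearizing function is the reciprocal of a quadratic polynomial, namely of
a discriminant of `Q`. -/
theorem exists_quadratic
    (h : LinearizesNear Q f D (α (0, 0)) (α (1, 0)) (α (0, 1)) (α (1, 1)) e p)
    (hQ : IsMultilinear Q) {i k l : Vertex} (hik : i ≠ k) (hil : i ≠ l) (hkl : l ≠ k) :
    ∃ A B C κ : ℂ, κ ≠ 0 ∧
      (∀ x, bidisc Q l k (Function.update p i x) = A * x ^ 2 + B * x + C) ∧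
      ∀ x ∈ D, (A * x ^ 2 + B * x + C) * deriv f x = κ := by
  obtain ⟨A, B, C, hABC⟩ := hQ.exists_quadratic_bidisc l k i hil hik p
  have hreg : ∀ i, vslope Q i p ≠ 0 := fun i => by
    rw [← hQ.partialDeriv_eq]
    exact h.regular i
  have hα := h.coeff_ne hQ
  have hκ : bidisc Q i k p * α l * deriv f (p l) / α i ≠ 0 := by
    rw [hQ.bidisc_of_zero hik h.solution]
    exact div_ne_zero (mul_ne_zero (mul_ne_zero (mul_ne_zero (hreg i) (hreg k)) (hα l))
      (h.deriv_ne_zero _ (h.mem l))) (hα i)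
  refine ⟨A, B, C, _, hκ, hABC, ?_⟩
  have hupd : Filter.Tendsto (fun t : ℂ => Function.update p i t) (𝓝 (p i)) (𝓝 p) := by
    have : Continuous (fun t : ℂ => Function.update p i t) :=
      continuous_const.update i continuous_id
    simpa using this.tendsto (p i)
  have hct := (hQ.tendsto_solve (hreg k) h.solution).comp hupd
  -- At the zero with `u_i = x`, `u_l = p l` and `u_k` solved for, the gradient relation for `i`,
  -- `l` multiplied by `Q_k` compares the discriminants in `(l, k)` and `(i, k)`. The latter ignores
  -- `u_i` and `u_k`, so it keeps its value at `p`.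
  have hloc : ∀ᶠ x in 𝓝 (p i), (A * x ^ 2 + B * x + C) * deriv f x =
      bidisc Q i k p * α l * deriv f (p l) / α i := by
    filter_upwards [hct.eventually (h.eventually hQ),
      hupd.eventually ((hQ.continuous_slope k).continuousAt.eventually_ne (hreg k))] with x h1 h2
    have h3 := h1 (hQ.solve_eq_zero h2)
    simp only [Function.comp_apply] at h3
    have hg := h3.gradient hQ hil
    have hui : solve Q k (Function.update p i x) i = x := by simp [solve, hik]
    have hul : solve Q k (Function.update p i x) l = p l := by simp [solve, hkl, hil.symm]
    have b1 : bidisc Q l k (solve Q k (Function.update p i x)) =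
        bidisc Q l k (Function.update p i x) := bidisc_update_right Q hkl _ _
    have b2 : bidisc Q i k (solve Q k (Function.update p i x)) = bidisc Q i k p :=
      (bidisc_update_right Q hik _ _).trans (bidisc_update_left Q _ _)
    rw [← hABC, ← b1, ← b2, hQ.bidisc_of_zero hkl h3.solution, hQ.bidisc_of_zero hik h3.solution,
      eq_div_iff (hα i)]
    rw [hui, hul] at hg
    linear_combination -(vslope Q k (solve Q k (Function.update p i x))) * hg
  -- The identity theorem carries the local relation to all of the connected set `D`.
  have hfan : AnalyticOnNhd ℂ (fun x => (A * x ^ 2 + B * x + C) * deriv f x) D :=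
    AnalyticOnNhd.mul
      (DifferentiableOn.analyticOnNhd (by fun_prop) h.isOpen) (h.differentiableOn.analyticOnNhd h.isOpen).deriv
  exact fun x hx => hfan.eqOn_of_preconnected_of_eventuallyEq analyticOnNhd_const
    h.isConnected.isPreconnected (h.mem i) hloc hx

end LinearizesNear

/-! ### Möbius transformations and invariance under equivalence. -/

theorem involutive_of_eq_id_or_swap {σ : Vertex → Vertex} (hσ : σ = id ∨ σ = Prod.swap) :
    Function.Involutive σ := by
  rcases hσ with rfl | rfl
  · exact fun _ => rfl
  · exact Prod.swap_swap

theorem comp_eq_id_or_swap {σ τ : Vertex → Vertex} (hσ : σ = id ∨ σ = Prod.swap)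
    (hτ : τ = id ∨ τ = Prod.swap) : τ ∘ σ = id ∨ τ ∘ σ = Prod.swap := by
  rcases hσ with rfl | rfl <;> rcases hτ with rfl | rfl <;> simp

section Mobius

variable {b₁ b₂ b₃ b₄ : ℂ}

theorem finite_pole (hb : b₁ * b₄ - b₂ * b₃ ≠ 0) : {x : ℂ | b₃ * x + b₄ = 0}.Finite := by
  by_cases h3 : b₃ = 0
  · have h4 : b₄ ≠ 0 := by
      rintro rfl
      simp [h3] at hb
    simp [h3, h4]
  · refine (Set.finite_singleton (-b₄ / b₃)).subset fun x hx => ?_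
    have hx' : b₃ * x + b₄ = 0 := hx
    rw [Set.mem_singleton_iff, eq_div_iff h3]
    linear_combination hx'

theorem mobius_den_inv {u : ℂ} (hu : b₁ - b₃ * u ≠ 0) :
    b₃ * ((b₄ * u - b₂) / (b₁ - b₃ * u)) + b₄ = (b₁ * b₄ - b₂ * b₃) / (b₁ - b₃ * u) := by
  rw [eq_div_iff hu, add_mul, mul_assoc, div_mul_cancel₀ _ hu]
  ring

theorem mobius_apply_inv (hb : b₁ * b₄ - b₂ * b₃ ≠ 0) {u : ℂ} (hu : b₁ - b₃ * u ≠ 0) :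
    (b₁ * ((b₄ * u - b₂) / (b₁ - b₃ * u)) + b₂) / (b₃ * ((b₄ * u - b₂) / (b₁ - b₃ * u)) + b₄) =
      u := by
  rw [mobius_den_inv hu, div_eq_iff (div_ne_zero hb hu), ← mul_left_inj' hu, add_mul,
    mul_assoc, div_mul_cancel₀ _ hu, mul_assoc, div_mul_cancel₀ _ hu]
  ring

theorem mobius_den {v : ℂ} (hv : b₃ * v + b₄ ≠ 0) :
    b₁ - b₃ * ((b₁ * v + b₂) / (b₃ * v + b₄)) = (b₁ * b₄ - b₂ * b₃) / (b₃ * v + b₄) := by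
  rw [eq_div_iff hv, sub_mul, mul_assoc, div_mul_cancel₀ _ hv]
  ring

theorem mobius_inv_apply (hb : b₁ * b₄ - b₂ * b₃ ≠ 0) {v : ℂ} (hv : b₃ * v + b₄ ≠ 0) :
    (b₄ * ((b₁ * v + b₂) / (b₃ * v + b₄)) - b₂) / (b₁ - b₃ * ((b₁ * v + b₂) / (b₃ * v + b₄))) =
      v := by
  rw [mobius_den hv, div_eq_iff (div_ne_zero hb hv), ← mul_left_inj' hv, sub_mul,
    mul_assoc, div_mul_cancel₀ _ hv, mul_assoc, div_mul_cancel₀ _ hv]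
  ring

theorem hasDerivAt_mobius {x : ℂ} (hx : b₃ * x + b₄ ≠ 0) :
    HasDerivAt (fun x => (b₁ * x + b₂) / (b₃ * x + b₄))
      ((b₁ * b₄ - b₂ * b₃) / (b₃ * x + b₄) ^ 2) x := by
  have h1 : HasDerivAt (fun x => b₁ * x + b₂) b₁ x := by
    simpa using ((hasDerivAt_id' x).const_mul b₁).add_const b₂
  have h2 : HasDerivAt (fun x => b₃ * x + b₄) b₃ x := by
    simpa using ((hasDerivAt_id' x).const_mul b₃).add_const b₄
  convert! h1.div h2 hx using 1
  ring

end Mobius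

theorem MobiusEquiv.symm {Q P : QuadFun} (h : MobiusEquiv Q P) : MobiusEquiv P Q := by
  obtain ⟨b₁, b₂, b₃, b₄, k, hb, hk, σ, hσ, h⟩ := h
  have hi := involutive_of_eq_id_or_swap hσ
  -- The inverse matrix; the fourth power arises because each of the four vertices contributes one
  -- determinant when the denominators are cleared.
  refine ⟨b₄, -b₂, -b₃, b₁, (k * (b₁ * b₄ - b₂ * b₃) ^ 4)⁻¹, by
    rwa [mul_comm b₄ b₁, neg_mul_neg], inv_ne_zero (mul_ne_zero hk (pow_ne_zero _ hb)), σ, hσ,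
    fun u hu => ?_⟩
  have hu' : ∀ i, b₁ - b₃ * u i ≠ 0 := fun i => by
    have := hu i
    rwa [neg_mul, neg_add_eq_sub] at this
  simp only [neg_mul, neg_add_eq_sub, ← sub_eq_add_neg]
  rw [h _ fun i => by
    rw [mobius_den_inv (hu' _)]
    exact div_ne_zero hb (hu' _)]
  simp only [mobius_apply_inv hb (hu' _)]
  simp only [mobius_den_inv (hu' _), hi _]
  rw [hi.bijective.prod_comp fun i => (b₁ * b₄ - b₂ * b₃) / (b₁ - b₃ * u i),
    Finset.prod_div_distrib, Finset.prod_const]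
  have hp : ∏ i, (b₁ - b₃ * u i) ≠ 0 := Finset.prod_ne_zero_iff.2 fun i _ => hu' i
  have hcard : (Finset.univ : Finset Vertex).card = 4 := rfl
  rw [hcard]
  field_simp

theorem MobiusEquiv.trans {Q P R : QuadFun} (hQ : IsMultilinear Q) (hR : IsMultilinear R)
    (h₁ : MobiusEquiv Q P) (h₂ : MobiusEquiv P R) : MobiusEquiv Q R := by
  obtain ⟨b₁, b₂, b₃, b₄, k, hb, hk, σ, hσ, h⟩ := h₁
  obtain ⟨c₁, c₂, c₃, c₄, l, hc, hl, τ, hτ, h'⟩ := h₂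
  have hρ := comp_eq_id_or_swap hσ hτ
  have hτi := involutive_of_eq_id_or_swap hτ
  have hd : (b₁ * c₁ + b₂ * c₃) * (b₃ * c₂ + b₄ * c₄) -
      (b₁ * c₂ + b₂ * c₄) * (b₃ * c₁ + b₄ * c₃) ≠ 0 := by
    convert mul_ne_zero hb hc using 1
    ring
  obtain ⟨P', hP', hP'Q⟩ := hQ.comp_affine (b₁ * c₁ + b₂ * c₃) (b₁ * c₂ + b₂ * c₄)
    (b₃ * c₁ + b₄ * c₃) (b₃ * c₂ + b₄ * c₄) _ (involutive_of_eq_id_or_swap hρ).bijective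
  have hden : ∀ x, c₃ * x + c₄ ≠ 0 → b₃ * ((c₁ * x + c₂) / (c₃ * x + c₄)) + b₄ =
      ((b₃ * c₁ + b₄ * c₃) * x + (b₃ * c₂ + b₄ * c₄)) / (c₃ * x + c₄) := by
    intro x hx
    rw [eq_div_iff hx, add_mul, mul_assoc, div_mul_cancel₀ _ hx]
    ring
  have hnum : ∀ x, c₃ * x + c₄ ≠ 0 → b₁ * ((c₁ * x + c₂) / (c₃ * x + c₄)) + b₂ =
      ((b₁ * c₁ + b₂ * c₃) * x + (b₁ * c₂ + b₂ * c₄)) / (c₃ * x + c₄) := by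
    intro x hx
    rw [eq_div_iff hx, add_mul, mul_assoc, div_mul_cancel₀ _ hx]
    ring
  -- Composition is valid only off the poles of the inner map, while the equivalence must hold
  -- wherever the composite is finite. Both sides are multilinear, so density removes the extra
  -- restriction.
  have key : R = fun w => l * k * P' w := by
    refine hR.eq_of_eq_off_finite (hP'.const_mul _) _ ((finite_pole hc).union (finite_pole hd))
      fun w hw => ?_
    have hw1 : ∀ i, c₃ * w i + c₄ ≠ 0 := fun i hi => hw i (Or.inl hi)
    have hw2 : ∀ i, (b₃ * c₁ + b₄ * c₃) * w i + (b₃ * c₂ + b₄ * c₄) ≠ 0 :=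
      fun i hi => hw i (Or.inr hi)
    rw [h' w hw1, h _ fun i => by
      rw [hden _ (hw1 _)]
      exact div_ne_zero (hw2 _) (hw1 _), hP'Q w hw2]
    simp only [hden _ (hw1 _), hnum _ (hw1 _), div_div_div_cancel_right₀ (hw1 _)]
    rw [hτi.bijective.prod_comp fun i =>
      ((b₃ * c₁ + b₄ * c₃) * w i + (b₃ * c₂ + b₄ * c₄)) / (c₃ * w i + c₄),
      Finset.prod_div_distrib]
    have hp : ∏ i, (c₃ * w i + c₄) ≠ 0 := Finset.prod_ne_zero_iff.2 fun i _ => hw1 i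
    simp only [Function.comp_apply]
    field_simp
  refine ⟨_, _, _, _, l * k, hd, mul_ne_zero hl hk, _, hρ, fun v hv => ?_⟩
  rw [key]
  simp only [hP'Q v hv, mul_assoc]

/-- A linearizing transformation of `Q = 0` becomes one of a Möbius equivalent equation. -/
theorem LinearizesNear.mobius {Q P : QuadFun} {f : ℂ → ℂ} {D : Set ℂ} {α : Vertex → ℂ} {e : ℂ}
    {p : Vertex → ℂ} (hQ : IsMultilinear Q)
    (h : LinearizesNear Q f D (α (0, 0)) (α (1, 0)) (α (0, 1)) (α (1, 1)) e p)
    {b₁ b₂ b₃ b₄ k : ℂ} (hb : b₁ * b₄ - b₂ * b₃ ≠ 0) (hk : k ≠ 0) {σ : Vertex → Vertex}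
    (hσ : σ = id ∨ σ = Prod.swap)
    (hP : ∀ v : Vertex → ℂ, (∀ i, b₃ * v i + b₄ ≠ 0) → P v = k * (∏ i, (b₃ * v i + b₄)) *
      Q (fun i => (b₁ * v (σ i) + b₂) / (b₃ * v (σ i) + b₄)))
    (hD : ∀ x ∈ D, b₁ - b₃ * x ≠ 0) :
    LinearizesNear P (fun x => f ((b₁ * x + b₂) / (b₃ * x + b₄)))
      {x | b₃ * x + b₄ ≠ 0 ∧ (b₁ * x + b₂) / (b₃ * x + b₄) ∈ D}
      (α (σ (0, 0))) (α (σ (1, 0))) (α (σ (0, 1))) (α (σ (1, 1))) e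
      (fun i => (b₄ * p (σ i) - b₂) / (b₁ - b₃ * p (σ i))) := by
  have hi := involutive_of_eq_id_or_swap hσ
  have hpole : ∀ i, b₁ - b₃ * p i ≠ 0 := fun i => hD _ (h.mem i)
  have hden : ∀ i, b₃ * ((b₄ * p (σ i) - b₂) / (b₁ - b₃ * p (σ i))) + b₄ ≠ 0 := fun i => by
    rw [mobius_den_inv (hpole _)]
    exact div_ne_zero hb (hpole _)
  have himg : {x | b₃ * x + b₄ ≠ 0 ∧ (b₁ * x + b₂) / (b₃ * x + b₄) ∈ D} =
      (fun u => (b₄ * u - b₂) / (b₁ - b₃ * u)) '' D := by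
    ext x
    constructor
    · rintro ⟨hx1, hx2⟩
      exact ⟨_, hx2, mobius_inv_apply hb hx1⟩
    · rintro ⟨u, hu, rfl⟩
      refine ⟨?_, ?_⟩
      · rw [mobius_den_inv (hD u hu)]
        exact div_ne_zero hb (hD u hu)
      · rwa [mobius_apply_inv hb (hD u hu)]
  have hdiff : ∀ x, b₃ * x + b₄ ≠ 0 → (b₁ * x + b₂) / (b₃ * x + b₄) ∈ D →
      HasDerivAt (fun x => f ((b₁ * x + b₂) / (b₃ * x + b₄)))
        (deriv f ((b₁ * x + b₂) / (b₃ * x + b₄)) * ((b₁ * b₄ - b₂ * b₃) / (b₃ * x + b₄) ^ 2)) x :=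
    fun x hx1 hx2 => (h.hasDerivAt hx2).comp x (hasDerivAt_mobius hx1)
  have hopen : IsOpen {x : ℂ | b₃ * x + b₄ ≠ 0} := isOpen_ne_fun (by fun_prop) continuous_const
  refine ⟨?_, ?_, ?_, ?_, ?_, ?_, ?_, ?_, ?_⟩
  · refine ContinuousOn.isOpen_inter_preimage (fun x hx => ?_) hopen h.isOpen
    exact (hasDerivAt_mobius hx).continuousAt.continuousWithinAt
  · rw [himg]
    refine h.isConnected.image _ fun u hu => ContinuousAt.continuousWithinAt ?_
    exact ContinuousAt.div (by fun_prop) (by fun_prop) (hD u hu)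
  · exact fun x hx => (hdiff x hx.1 hx.2).differentiableAt.differentiableWithinAt
  · intro x hx
    rw [(hdiff x hx.1 hx.2).deriv]
    exact mul_ne_zero (h.deriv_ne_zero _ hx.2) (div_ne_zero hb (pow_ne_zero _ hx.1))
  · exact Or.inl (h.coeff_ne hQ _)
  · refine fun i => ⟨hden i, ?_⟩
    rw [mobius_apply_inv hb (hpole _)]
    exact h.mem _
  · rw [hP _ hden]
    simp only [mobius_apply_inv hb (hpole _), hi _, h.solution, mul_zero]
  · intro i
    set q : Vertex → ℂ := fun i => (b₄ * p (σ i) - b₂) / (b₁ - b₃ * p (σ i)) with hq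
    have hMq : ∀ m, (b₁ * q m + b₂) / (b₃ * q m + b₄) = p (σ m) :=
      fun m => mobius_apply_inv hb (hpole _)
    -- As `Q p = 0`, varying one variable gives `Q = (M t - p (σ i)) *` slope, `M` being the Möbius
    -- map. The factor `b₃ * t + b₄` cancels the denominator of `M t`, leaving an affine function of
    -- `t`.
    have hloc : ∀ᶠ t in 𝓝 (q i), P (Function.update q i t) =
        k * (∏ m ∈ Finset.univ.erase i, (b₃ * q m + b₄)) * vslope Q (σ i) p *
          ((b₁ - b₃ * p (σ i)) * t + (b₂ - b₄ * p (σ i))) := by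
      filter_upwards [hopen.mem_nhds (hden i)] with t ht
      have ht' : b₃ * t + b₄ ≠ 0 := ht
      rw [hP _ fun m => by
        by_cases hm : m = i
        · subst hm
          simpa using ht'
        · simpa [hm] using hden m]
      have hupd : (fun m => (b₁ * Function.update q i t (σ m) + b₂) /
          (b₃ * Function.update q i t (σ m) + b₄)) =
          Function.update p (σ i) ((b₁ * t + b₂) / (b₃ * t + b₄)) := by
        ext m
        by_cases hm : m = σ i
        · subst hm
          simp [hi i]
        · have : σ m ≠ i := fun h => hm (by rw [← h, hi])
          rw [Function.update_of_ne this, Function.update_of_ne hm, hMq, hi]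
      rw [hupd, hQ.update_of_zero h.solution, ← Finset.mul_prod_erase _ _ (Finset.mem_univ i),
        Function.update_self, Finset.prod_congr rfl fun m hm => by
          rw [Function.update_of_ne (Finset.ne_of_mem_erase hm)]]
      field_simp
      ring
    have hder : HasDerivAt (fun t => P (Function.update q i t))
        (k * (∏ m ∈ Finset.univ.erase i, (b₃ * q m + b₄)) * vslope Q (σ i) p *
          (b₁ - b₃ * p (σ i))) (q i) := by
      refine HasDerivAt.congr_of_eventuallyEq ?_ hloc
      refine HasDerivAt.const_mul _ ?_
      simpa using ((hasDerivAt_id' (q i)).const_mul (b₁ - b₃ * p (σ i))).add_const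
        (b₂ - b₄ * p (σ i))
    rw [partialDeriv, hder.deriv]
    have hr := h.regular (σ i)
    rw [hQ.partialDeriv_eq] at hr
    exact mul_ne_zero (mul_ne_zero (mul_ne_zero hk
      (Finset.prod_ne_zero_iff.2 fun m _ => hden m)) hr) (hpole _)
  · set q : Vertex → ℂ := fun i => (b₄ * p (σ i) - b₂) / (b₁ - b₃ * p (σ i)) with hq
    have htend : Filter.Tendsto (fun v : Vertex → ℂ => fun i =>
        (b₁ * v (σ i) + b₂) / (b₃ * v (σ i) + b₄)) (𝓝 q) (𝓝 p) := by
      refine tendsto_pi_nhds.2 fun i => ?_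
      have h1 : ContinuousAt (fun v : Vertex → ℂ => (b₁ * v (σ i) + b₂) / (b₃ * v (σ i) + b₄)) q :=
        ContinuousAt.comp (g := fun x : ℂ => (b₁ * x + b₂) / (b₃ * x + b₄))
          (f := fun v : Vertex → ℂ => v (σ i)) (hasDerivAt_mobius (hden (σ i))).continuousAt
          (continuous_apply (σ i)).continuousAt
      have h2 : (b₁ * q (σ i) + b₂) / (b₃ * q (σ i) + b₄) = p i := by
        simp only [hq, mobius_apply_inv hb (hpole _), hi _]
      simpa only [ContinuousAt, h2] using h1
    have hne : ∀ᶠ v in 𝓝 q, ∀ i, b₃ * v i + b₄ ≠ 0 := Filter.eventually_all.2 fun i =>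
      ((continuous_apply i).tendsto q).eventually (hopen.mem_nhds (hden i))
    filter_upwards [htend.eventually h.linear, hne] with v hv1 hv2 hv0
    rw [hP v hv2] at hv0
    have h0 := hv1 ((mul_eq_zero.1 hv0).resolve_left
      (mul_ne_zero hk (Finset.prod_ne_zero_iff.2 fun i _ => hv2 i)))
    rw [linearForm_eq_sum α] at h0
    rw [linearForm_eq_sum (fun i => α (σ i)), ← h0,
      ← hi.bijective.sum_comp fun i => α (σ i) * f ((b₁ * v i + b₂) / (b₃ * v i + b₄))]
    simp only [hi _]

/-- The value `b₁ / b₃`, which corresponds to infinity in the new coordinate, may lie in `D` or even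
be a coordinate of `p`. The base point is first moved off it, then `D` is punctured there. -/
theorem LinearizesNear.exists_of_mobiusEquiv {Q P : QuadFun} {f : ℂ → ℂ} {D : Set ℂ}
    {a b c d e : ℂ} {p : Vertex → ℂ} (hQ : IsMultilinear Q) (h : LinearizesNear Q f D a b c d e p)
    (hQP : MobiusEquiv Q P) : ∃ b₁ b₂ b₃ b₄ : ℂ, b₁ * b₄ - b₂ * b₃ ≠ 0 ∧
      ∃ (D' : Set ℂ) (a' b' c' d' : ℂ) (p' : Vertex → ℂ),
        (∀ x ∈ D', b₃ * x + b₄ ≠ 0 ∧ (b₁ * x + b₂) / (b₃ * x + b₄) ∈ D) ∧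
        LinearizesNear P (fun x => f ((b₁ * x + b₂) / (b₃ * x + b₄))) D' a' b' c' d' e p' := by
  obtain ⟨b₁, b₂, b₃, b₄, k, hb, hk, σ, hσ, hP⟩ := hQP
  have hfin : {x : ℂ | -b₃ * x + b₁ = 0}.Finite := finite_pole (b₁ := b₄) (b₂ := -b₂) (by
    rwa [mul_comm b₄ b₁, neg_mul_neg])
  obtain ⟨α, rfl, rfl, rfl, rfl⟩ := exists_coeff a b c d
  obtain ⟨u, hu, hub⟩ := h.exists_avoiding hQ hfin
  have hub' : ∀ i, b₁ - b₃ * u i ≠ 0 := fun i hi => hub i (by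
    rw [Set.mem_ofPred_eq]
    linear_combination hi)
  have hcase : ∃ D' ⊆ D, (∀ x ∈ D', b₁ - b₃ * x ≠ 0) ∧
      LinearizesNear Q f D' (α (0, 0)) (α (1, 0)) (α (0, 1)) (α (1, 1)) e u := by
    by_cases h3 : b₃ = 0
    · refine ⟨D, subset_rfl, fun x _ => ?_, hu⟩
      simpa [h3] using hub' (0, 0)
    · have hz : ∀ x, x ≠ b₁ / b₃ → b₁ - b₃ * x ≠ 0 := fun x hx h0 => hx (by
        rw [eq_div_iff h3]
        linear_combination -h0)
      refine ⟨D \ {b₁ / b₃}, Set.sdiff_subset, fun x hx => hz x hx.2, hu.diff_singleton ?_⟩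
      intro i hi
      apply hub' i
      rw [hi, mul_div_cancel₀ _ h3, sub_self]
  obtain ⟨D', hD'D, hD', hlin⟩ := hcase
  exact ⟨b₁, b₂, b₃, b₄, hb, _, _, _, _, _, _, fun x hx => ⟨hx.1, hD'D hx.2⟩,
    hlin.mobius hQ hb hk hσ hP hD'⟩

theorem Linearizable.of_mobiusEquiv {Q P : QuadFun} (hQ : IsMultilinear Q) (h : Linearizable Q)
    (hQP : MobiusEquiv Q P) : Linearizable P := by
  obtain ⟨f, D, a, b, c, d, e, p, h⟩ := h
  obtain ⟨b₁, b₂, b₃, b₄, -, D', a', b', c', d', p', -, h'⟩ := h.exists_of_mobiusEquiv hQ hQP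
  exact ⟨_, _, _, _, _, _, _, _, h'⟩

theorem LinearizableByMobius.of_mobiusEquiv {Q P : QuadFun} (hQ : IsMultilinear Q)
    (h : LinearizableByMobius Q) (hQP : MobiusEquiv Q P) : LinearizableByMobius P := by
  obtain ⟨c₁, c₂, c₃, c₄, hc, D, a, b, c, d, e, p, hD, h⟩ := h
  obtain ⟨b₁, b₂, b₃, b₄, hb, D', a', b', c', d', p', hD', h'⟩ := h.exists_of_mobiusEquiv hQ hQP
  have hden : ∀ x ∈ D', (c₃ * b₁ + c₄ * b₃) * x + (c₃ * b₂ + c₄ * b₄) ≠ 0 := by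
    intro x hx h0
    refine hD _ (hD' x hx).2 ?_
    have := (hD' x hx).1
    rw [← mul_left_inj' this, add_mul, mul_assoc, div_mul_cancel₀ _ this]
    linear_combination h0
  refine ⟨c₁ * b₁ + c₂ * b₃, c₁ * b₂ + c₂ * b₄, c₃ * b₁ + c₄ * b₃, c₃ * b₂ + c₄ * b₄, ?_, D', a', b',
    c', d', e, p', hden, h'.congr fun x hx => ?_⟩
  · convert mul_ne_zero hc hb using 1
    ring
  · have h1 := (hD' x hx).1
    have h2 := hD _ (hD' x hx).2
    have h3 := hden x hx
    simp only []
    rw [div_eq_div_iff h3 h2, ← mul_left_inj' h1]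
    have e : (b₁ * x + b₂) / (b₃ * x + b₄) * (b₃ * x + b₄) = b₁ * x + b₂ := div_mul_cancel₀ _ h1
    linear_combination (c₃ * ((c₁ * b₁ + c₂ * b₃) * x + (c₁ * b₂ + c₂ * b₄)) -
      c₁ * ((c₃ * b₁ + c₄ * b₃) * x + (c₃ * b₂ + c₄ * b₄))) * e

/-! ### Normal forms and binomial equations. -/

theorem isMultilinear_linearForm (a b c d e : ℂ) : IsMultilinear (linearForm a b c d e) :=
  (((((IsMultilinear.coord (0, 0)).const_mul a).add ((IsMultilinear.coord (1, 0)).const_mul b)).add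
    ((IsMultilinear.coord (0, 1)).const_mul c)).add
      ((IsMultilinear.coord (1, 1)).const_mul d)).add (IsMultilinear.const e)

theorem IsMultilinear.of_eq {Q R : QuadFun} (hQ : IsMultilinear Q) (h : ∀ u, R u = Q u) :
    IsMultilinear R := by
  rwa [funext h]

theorem isMultilinear_inversionForm (β γ δ ε : ℂ) : IsMultilinear (inversionForm β γ δ ε) := by
  refine IsMultilinear.of_eq
    (((((IsMultilinear.monomial {(0, 1), (1, 1), (1, 0)}).add
      ((IsMultilinear.monomial {(0, 1), (1, 1), (0, 0)}).const_mul β)).add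
      ((IsMultilinear.monomial {(0, 0), (1, 0), (1, 1)}).const_mul γ)).add
      ((IsMultilinear.monomial {(0, 0), (1, 0), (0, 1)}).const_mul δ)).add
      ((IsMultilinear.monomial {(0, 0), (1, 0), (0, 1), (1, 1)}).const_mul ε)) fun w => ?_
  simp [inversionForm]
  ring

/-- The sum of two multiples of complementary monomials. -/
def binomialForm (A B : ℂ) (S : Finset Vertex) : QuadFun := fun v =>
  A * ∏ i ∈ S, v i + B * ∏ i ∈ Sᶜ, v i

theorem isMultilinear_binomialForm (A B : ℂ) (S : Finset Vertex) :
    IsMultilinear (binomialForm A B S) :=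
  ((IsMultilinear.monomial S).const_mul A).add ((IsMultilinear.monomial Sᶜ).const_mul B)

theorem binomialForm_compl (A B : ℂ) (S : Finset Vertex) :
    binomialForm A B Sᶜ = binomialForm B A S := by
  ext v
  rw [binomialForm, binomialForm, compl_compl, add_comm]

theorem logForm1_eq : logForm1 = binomialForm 1 (-1) Finset.univ := by
  ext v
  simp [logForm1, binomialForm, Fintype.prod_prod_type, Fin.prod_univ_two]
  ring

theorem logForm2_eq : logForm2 = binomialForm (-1) 1 {(1, 1), (1, 0), (0, 1)} := by
  ext v
  have h : ({(1, 1), (1, 0), (0, 1)} : Finset Vertex)ᶜ = {(0, 0)} := by decide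
  simp [logForm2, binomialForm, h]
  ring

theorem logForm3_eq : logForm3 = binomialForm (-1) 1 {(1, 1), (0, 0), (0, 1)} := by
  ext v
  have h : ({(1, 1), (0, 0), (0, 1)} : Finset Vertex)ᶜ = {(1, 0)} := by decide
  simp [logForm3, binomialForm, h]
  ring

theorem logForm4_eq : logForm4 = binomialForm 1 (-1) {(1, 1)} := by
  ext v
  have h : ({(1, 1)} : Finset Vertex)ᶜ = {(0, 0), (1, 0), (0, 1)} := by decide
  simp [logForm4, binomialForm, h]
  ring

theorem logForm5_eq (θ : ℂ) : logForm5 θ = binomialForm 1 (-θ) {(1, 1), (0, 1)} := by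
  ext v
  have h : ({(1, 1), (0, 1)} : Finset Vertex)ᶜ = {(0, 0), (1, 0)} := by decide
  simp [logForm5, binomialForm, h]
  ring

theorem logForm6_eq (θ : ℂ) : logForm6 θ = binomialForm 1 (-θ) {(1, 1), (0, 0)} := by
  ext v
  have h : ({(1, 1), (0, 0)} : Finset Vertex)ᶜ = {(1, 0), (0, 1)} := by decide
  simp [logForm6, binomialForm, h]
  ring

/-- `P = 0` is equivalent to one of the six equations linearized by the logarithm. -/
def EquivLogForm (P : QuadFun) : Prop :=
  MobiusEquiv P logForm1 ∨ MobiusEquiv P logForm2 ∨ MobiusEquiv P logForm3 ∨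
    MobiusEquiv P logForm4 ∨
    ∃ θ : ℂ, θ ≠ 0 ∧ (MobiusEquiv P (logForm5 θ) ∨ MobiusEquiv P (logForm6 θ))

theorem EquivLogForm.of_mobiusEquiv {Q P : QuadFun} (hQ : IsMultilinear Q)
    (hQP : MobiusEquiv Q P) (h : EquivLogForm P) : EquivLogForm Q := by
  rcases h with h | h | h | h | ⟨θ, hθ, h | h⟩
  · exact Or.inl (hQP.trans hQ (logForm1_eq ▸ isMultilinear_binomialForm _ _ _) h)
  · exact Or.inr (Or.inl (hQP.trans hQ (logForm2_eq ▸ isMultilinear_binomialForm _ _ _) h))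
  · exact Or.inr (Or.inr (Or.inl (hQP.trans hQ (logForm3_eq ▸ isMultilinear_binomialForm _ _ _) h)))
  · exact Or.inr (Or.inr (Or.inr (Or.inl
      (hQP.trans hQ (logForm4_eq ▸ isMultilinear_binomialForm _ _ _) h))))
  · exact Or.inr (Or.inr (Or.inr (Or.inr ⟨θ, hθ, Or.inl
      (hQP.trans hQ (logForm5_eq θ ▸ isMultilinear_binomialForm _ _ _) h)⟩)))
  · exact Or.inr (Or.inr (Or.inr (Or.inr ⟨θ, hθ, Or.inr
      (hQP.trans hQ (logForm6_eq θ ▸ isMultilinear_binomialForm _ _ _) h)⟩)))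

theorem mobiusEquiv_of_scale {P R : QuadFun} {μ k : ℂ} (hμ : μ ≠ 0) (hk : k ≠ 0)
    {σ : Vertex → Vertex} (hσ : σ = id ∨ σ = Prod.swap)
    (h : ∀ w, R w = k * P (fun i => μ * w (σ i))) : MobiusEquiv P R :=
  ⟨μ, 0, 0, 1, k, by simpa using hμ, hk, σ, hσ, fun v _ => by simp [h]⟩

/-- Complementation exchanges `A` and `B`, so `(1, 1) ∈ S` may be assumed and eight sets remain. If
the two monomials have different degrees (4 and 0, or 3 and 1), scaling the variable normalizes
their ratio. If both have degree 2, the ratio is scale invariant and survives as `θ = -B / A`. The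
exchange of the axes handles the two sets not among the six forms. -/
theorem equivLogForm_binomialForm {A B : ℂ} (hA : A ≠ 0) (hB : B ≠ 0) (S : Finset Vertex) :
    EquivLogForm (binomialForm A B S) := by
  wlog hS : (1, 1) ∈ S generalizing A B S
  · rw [← binomialForm_compl]
    exact this hB hA Sᶜ (by simpa using hS)
  have hcases : ∀ S : Finset Vertex, (1, 1) ∈ S → S = Finset.univ ∨ S = {(1, 1), (1, 0), (0, 1)} ∨
      S = {(1, 1), (0, 0), (0, 1)} ∨ S = {(1, 1), (0, 0), (1, 0)} ∨ S = {(1, 1)} ∨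
      S = {(1, 1), (0, 1)} ∨ S = {(1, 1), (1, 0)} ∨ S = {(1, 1), (0, 0)} := by decide
  have hBA : -B / A ≠ 0 := div_ne_zero (neg_ne_zero.2 hB) hA
  have hAB : -A / B ≠ 0 := div_ne_zero (neg_ne_zero.2 hA) hB
  obtain ⟨μ, hμ⟩ := IsAlgClosed.exists_pow_nat_eq (-B / A) (n := 2) (by norm_num)
  have hμ0 : μ ≠ 0 := by
    rintro rfl
    exact hBA (by rw [← hμ]; simp)
  have hμA : A * μ ^ 2 = -B := by rw [hμ]; field_simp
  rcases hcases S hS with rfl | rfl | rfl | rfl | rfl | rfl | rfl | rfl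
  · left
    obtain ⟨ν, hν⟩ := IsAlgClosed.exists_pow_nat_eq (-B / A) (n := 4) (by norm_num)
    have hν0 : ν ≠ 0 := by
      rintro rfl
      exact hBA (by rw [← hν]; simp)
    have hνA : A * ν ^ 4 = -B := by rw [hν]; field_simp
    refine mobiusEquiv_of_scale hν0 (k := (-B)⁻¹) (inv_ne_zero (neg_ne_zero.2 hB)) (Or.inl rfl)
      fun w => ?_
    rw [eq_inv_mul_iff_mul_eq₀ (neg_ne_zero.2 hB)]
    simp [logForm1, binomialForm, Fintype.prod_prod_type, Fin.prod_univ_two]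
    linear_combination -(w (0, 0) * w (1, 0) * w (0, 1) * w (1, 1)) * hνA
  · right; left
    refine mobiusEquiv_of_scale hμ0 (k := (B * μ)⁻¹) (inv_ne_zero (mul_ne_zero hB hμ0))
      (Or.inl rfl) fun w => ?_
    rw [eq_inv_mul_iff_mul_eq₀ (mul_ne_zero hB hμ0)]
    have h : ({(1, 1), (1, 0), (0, 1)} : Finset Vertex)ᶜ = {(0, 0)} := by decide
    simp [logForm2, binomialForm, h]
    linear_combination -(μ * w (1, 0) * w (0, 1) * w (1, 1)) * hμA
  · right; right; left
    refine mobiusEquiv_of_scale hμ0 (k := (B * μ)⁻¹) (inv_ne_zero (mul_ne_zero hB hμ0))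
      (Or.inl rfl) fun w => ?_
    rw [eq_inv_mul_iff_mul_eq₀ (mul_ne_zero hB hμ0)]
    have h : ({(1, 1), (0, 0), (0, 1)} : Finset Vertex)ᶜ = {(1, 0)} := by decide
    simp [logForm3, binomialForm, h]
    linear_combination -(μ * w (0, 0) * w (0, 1) * w (1, 1)) * hμA
  · right; right; left
    refine mobiusEquiv_of_scale hμ0 (k := (B * μ)⁻¹) (inv_ne_zero (mul_ne_zero hB hμ0))
      (Or.inr rfl) fun w => ?_
    rw [eq_inv_mul_iff_mul_eq₀ (mul_ne_zero hB hμ0)]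
    have h : ({(1, 1), (0, 0), (1, 0)} : Finset Vertex)ᶜ = {(0, 1)} := by decide
    simp [logForm3, binomialForm, h]
    linear_combination -(μ * w (0, 0) * w (0, 1) * w (1, 1)) * hμA
  · right; right; right; left
    -- Here the cubic monomial carries `B`, so the reciprocal ratio is needed.
    obtain ⟨ν, hν⟩ := IsAlgClosed.exists_pow_nat_eq (-A / B) (n := 2) (by norm_num)
    have hν0 : ν ≠ 0 := by
      rintro rfl
      exact hAB (by rw [← hν]; simp)
    have hνB : B * ν ^ 2 = -A := by rw [hν]; field_simp
    refine mobiusEquiv_of_scale hν0 (k := (A * ν)⁻¹) (inv_ne_zero (mul_ne_zero hA hν0))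
      (Or.inl rfl) fun w => ?_
    rw [eq_inv_mul_iff_mul_eq₀ (mul_ne_zero hA hν0)]
    have h : ({(1, 1)} : Finset Vertex)ᶜ = {(0, 0), (1, 0), (0, 1)} := by decide
    simp [logForm4, binomialForm, h]
    linear_combination -(ν * w (0, 0) * w (1, 0) * w (0, 1)) * hνB
  · right; right; right; right
    refine ⟨-B / A, hBA, Or.inl (mobiusEquiv_of_scale one_ne_zero (k := A⁻¹) (inv_ne_zero hA)
      (Or.inl rfl) fun w => ?_)⟩
    have h : ({(1, 1), (0, 1)} : Finset Vertex)ᶜ = {(0, 0), (1, 0)} := by decide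
    simp [logForm5, binomialForm, h]
    field_simp
    ring
  · right; right; right; right
    refine ⟨-B / A, hBA, Or.inl (mobiusEquiv_of_scale one_ne_zero (k := A⁻¹) (inv_ne_zero hA)
      (Or.inr rfl) fun w => ?_)⟩
    have h : ({(1, 1), (1, 0)} : Finset Vertex)ᶜ = {(0, 0), (0, 1)} := by decide
    simp [logForm5, binomialForm, h]
    field_simp
    ring
  · right; right; right; right
    refine ⟨-B / A, hBA, Or.inr (mobiusEquiv_of_scale one_ne_zero (k := A⁻¹) (inv_ne_zero hA)
      (Or.inl rfl) fun w => ?_)⟩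
    have h : ({(1, 1), (0, 0)} : Finset Vertex)ᶜ = {(1, 0), (0, 1)} := by decide
    simp [logForm6, binomialForm, h]
    field_simp
    ring

/-! ### From a linearization to a normal form. -/

/-- An equation linearized by the logarithm of a Möbius coordinate is a binomial. -/
theorem LinearizesNear.eq_binomialForm {P : QuadFun} {f : ℂ → ℂ} {D : Set ℂ} {α : Vertex → ℂ}
    {e κ : ℂ} {p : Vertex → ℂ} (hP : IsMultilinear P)
    (h : LinearizesNear P f D (α (0, 0)) (α (1, 0)) (α (0, 1)) (α (1, 1)) e p)
    (hκ : κ ≠ 0) (hf : ∀ x ∈ D, x * deriv f x = κ) :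
    ∃ A B S, A ≠ 0 ∧ B ≠ 0 ∧ P = binomialForm A B S := by
  have hα := h.coeff_ne hP
  have hreg : ∀ i, vslope P i p ≠ 0 := fun i => by
    rw [← hP.partialDeriv_eq]
    exact h.regular i
  have hD : ∀ x ∈ D, x ≠ 0 := by
    rintro x hx rfl
    exact hκ (by rw [← hf 0 hx, zero_mul])
  obtain ⟨a, ha⟩ := hP
  have hP : IsMultilinear P := ⟨a, ha⟩
  -- The indicator of `i ∉ S`: setting `u i = 0` multiplies the coefficient of `S` by `χ S i`.
  set χ : Finset Vertex → Vertex → ℂ := fun S i => if i ∈ S then 0 else 1 with hχ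
  have hupd : ∀ i u, P (Function.update u i 0) = ∑ S, (χ S i * a S) * ∏ m ∈ S, u m := by
    intro i u
    rw [ha]
    refine Finset.sum_congr rfl fun S _ => ?_
    by_cases hi : i ∈ S
    · simp [hχ, hi, Finset.prod_update_of_mem hi]
    · simp [hχ, hi, Finset.prod_update_of_notMem hi]
  have hmulti : ∀ i, IsMultilinear (fun u => P (Function.update u i 0)) :=
    fun i => ⟨_, hupd i⟩
  -- The relation `α j * u i * P_i = α i * u j * P_j` on `P = 0`, rewritten through `P|_{u i = 0} =
  -- -u i * P_i`, says that a multilinear function vanishes on `P = 0`. It is therefore `c * P`.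
  have key : ∀ i j, i ≠ j → ∃ c, ∀ S, (α j * χ S i - α i * χ S j - c) * a S = 0 := by
    intro i j hij
    obtain ⟨c, hc⟩ := hP.eq_const_mul_of_zero
      (((hmulti i).const_mul (α j)).sub ((hmulti j).const_mul (α i))) h.solution hreg (by
        filter_upwards [h.eventually hP] with u hu hu0
        have hl := hu hu0
        have hg := hl.gradient hP hij
        have hi := hf _ (hl.mem i)
        have hj := hf _ (hl.mem j)
        have e1 := hP.update_of_zero hu0 i 0
        have e2 := hP.update_of_zero hu0 j 0
        rw [e1, e2]
        apply (mul_eq_zero.1 (_ : κ * _ = 0)).resolve_left hκ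
        linear_combination -(u i * u j) * hg + α j * u i * vslope P i u * hj -
          α i * u j * vslope P j u * hi)
    refine ⟨c, IsMultilinear.coeff_eq_zero fun u => ?_⟩
    have := hc u
    simp only [hupd] at this
    rw [ha, Finset.mul_sum, Finset.mul_sum, Finset.mul_sum, ← Finset.sum_sub_distrib, ← sub_eq_zero,
      ← Finset.sum_sub_distrib] at this
    rw [← this]
    exact Finset.sum_congr rfl fun S _ => by ring
  -- Eliminating `c` between two occurring monomials makes `χ S - χ T` proportional to `α`. No `α i`
  -- is zero, so `S` and `T` differ at every vertex or at none.
  have hcompl : ∀ S T, a S ≠ 0 → a T ≠ 0 → S ≠ T → T = Sᶜ := by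
    intro S T hS hT hST
    have hrel : ∀ i j, i ≠ j → α j * (χ S i - χ T i) = α i * (χ S j - χ T j) := by
      intro i j hij
      obtain ⟨c, hc⟩ := key i j hij
      have h1 := (mul_eq_zero.1 (hc S)).resolve_right hS
      have h2 := (mul_eq_zero.1 (hc T)).resolve_right hT
      linear_combination h1 - h2
    have hiff : ∀ i, (i ∈ S ↔ i ∈ T) ↔ χ S i - χ T i = 0 := by
      intro i
      by_cases h1 : i ∈ S <;> by_cases h2 : i ∈ T <;> simp [hχ, h1, h2]
    obtain ⟨j, hj⟩ : ∃ j, ¬(j ∈ S ↔ j ∈ T) := by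
      by_contra! hall
      exact hST (Finset.ext hall)
    ext i
    rw [Finset.mem_compl]
    have : ¬(i ∈ S ↔ i ∈ T) := by
      by_cases hij : i = j
      · rwa [hij]
      · rw [hiff] at hj ⊢
        intro h0
        have := hrel i j hij
        rw [h0, mul_zero] at this
        exact mul_ne_zero (hα i) hj this.symm
    tauto
  obtain ⟨S, hS⟩ : ∃ S, a S ≠ 0 := by
    by_contra! hall
    exact hreg (0, 0) (by simp [vslope, ha, hall])
  -- A single monomial cannot vanish at `p`, whose coordinates are nonzero.
  obtain ⟨T, hT, hST⟩ : ∃ T, a T ≠ 0 ∧ S ≠ T := by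
    by_contra! hall
    have h0 := h.solution
    rw [ha, Finset.sum_eq_single S (fun T _ hTS => by
      by_cases hT : a T = 0
      · rw [hT, zero_mul]
      · exact absurd (hall T hT).symm hTS) (by simp)] at h0
    exact mul_ne_zero hS (Finset.prod_ne_zero_iff.2 fun i _ => hD _ (h.mem i)) h0
  have hTS := hcompl S T hS hT hST
  subst hTS
  refine ⟨a S, a Sᶜ, S, hS, hT, ?_⟩
  ext u
  rw [ha, ← Finset.sum_subset (Finset.subset_univ {S, Sᶜ}) (fun T _ hTm => ?_),
    Finset.sum_pair hST, binomialForm]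
  by_cases hT0 : a T = 0
  · rw [hT0, zero_mul]
  · simp only [Finset.mem_insert, Finset.mem_singleton, not_or] at hTm
    exact absurd (hcompl S T hS hT0 (Ne.symm hTm.1)) hTm.2

theorem quadratic_coeff_eq_zero {D : Set ℂ} (hD : IsOpen D) (hne : D.Nonempty) {A B C : ℂ}
    (h : ∀ x ∈ D, A * x ^ 2 + B * x + C = 0) : A = 0 ∧ B = 0 ∧ C = 0 := by
  obtain ⟨x, hx⟩ := hne
  obtain ⟨r, hr, hball⟩ := Metric.isOpen_iff.1 hD x hx
  set t : ℂ := ((r / 2 : ℝ) : ℂ) with ht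
  have ht0 : t ≠ 0 := by
    rw [ht, Complex.ofReal_ne_zero]
    positivity
  have hnorm : ‖t‖ < r := by
    rw [ht, Complex.norm_real, Real.norm_eq_abs, abs_of_pos (by positivity)]
    linarith
  have h0 := h x hx
  have h1 := h (x + t) (hball (by simpa [dist_eq_norm] using hnorm))
  have h2 := h (x - t) (hball (by simpa [dist_eq_norm] using hnorm))
  have hA : A = 0 := by
    apply (mul_eq_zero.1 (_ : (2 * t ^ 2) * A = 0)).resolve_left
      (mul_ne_zero two_ne_zero (pow_ne_zero _ ht0))
    linear_combination h1 + h2 - 2 * h0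
  have hB : B = 0 := by
    apply (mul_eq_zero.1 (_ : t * B = 0)).resolve_left ht0
    linear_combination h1 - h0 - (2 * x * t + t ^ 2) * hA
  exact ⟨hA, hB, by linear_combination h0 - x ^ 2 * hA - x * hB⟩

/-- An equation with a discriminant that has a simple zero is not linearizable by a Möbius
transformation. -/
theorem not_linearizableByMobius_of_bidisc {P : QuadFun} (hP : IsMultilinear P)
    (h : ∀ u x, bidisc P (1, 0) (0, 1) (Function.update u (0, 0) x) =
      x * bidisc P (1, 0) (0, 1) (Function.update u (0, 0) 1)) : ¬ LinearizableByMobius P := by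
  rintro ⟨c₁, c₂, c₃, c₄, hc, D, a, b, c, d, e, p, hD, hlin⟩
  obtain ⟨α, rfl, rfl, rfl, rfl⟩ := exists_coeff a b c d
  obtain ⟨A, B, C, κ, hκ, hquad, hder⟩ := hlin.exists_quadratic hP (i := (0, 0)) (k := (0, 1))
    (l := (1, 0)) (by decide) (by decide) (by decide)
  have hquad' := fun x => (h p x).symm.trans (hquad x)
  set E := bidisc P (1, 0) (0, 1) (Function.update p (0, 0) 1)
  have q0 := hquad' 0
  have q1 := hquad' 1
  have q2 := hquad' (-1)
  have hC : C = 0 := by linear_combination -q0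
  have hA : A = 0 := by linear_combination -(1 / 2) * q1 - (1 / 2) * q2 - hC
  -- With `A = C = 0` and the Möbius derivative inserted, `κ * (c₃ * x + c₄) ^ 2` is a multiple of
  -- `x` on `D`, which forces `c₃ = c₄ = 0`.
  have := quadratic_coeff_eq_zero hlin.isOpen hlin.isConnected.nonempty (A := κ * c₃ ^ 2)
    (B := 2 * κ * c₃ * c₄ - B * (c₁ * c₄ - c₂ * c₃)) (C := κ * c₄ ^ 2) fun x hx => by
      have h1 := hder x hx
      rw [(hasDerivAt_mobius (hD x hx)).deriv, hA, hC] at h1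
      have h2 := hD x hx
      rw [mul_div_assoc', div_eq_iff (pow_ne_zero _ h2)] at h1
      linear_combination -h1
  have h3 : c₃ = 0 := by simpa [hκ] using this.1
  have h4 : c₄ = 0 := by simpa [hκ] using this.2.2
  exact hc (by rw [h3, h4]; ring)

/-- A primitive of the reciprocal of a quadratic polynomial with a double root (possibly at
infinity) is a Möbius transformation. -/
theorem exists_mobius_of_double_root {f : ℂ → ℂ} {D : Set ℂ} (hD : IsOpen D) (hc : IsConnected D)
    (hf : DifferentiableOn ℂ f D) {A B C κ : ℂ} (hκ : κ ≠ 0)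
    (hq : ∀ x ∈ D, (A * x ^ 2 + B * x + C) * deriv f x = κ) (hdisc : B ^ 2 = 4 * A * C) :
    ∃ c₁ c₂ c₃ c₄ : ℂ, c₁ * c₄ - c₂ * c₃ ≠ 0 ∧ (∀ x ∈ D, c₃ * x + c₄ ≠ 0) ∧
      Set.EqOn (fun x => (c₁ * x + c₂) / (c₃ * x + c₄)) f D := by
  obtain ⟨x₀, hx₀⟩ := hc.nonempty
  -- A Möbius primitive of `f'` differs from `f` by a constant, and adding a constant keeps it
  -- Möbius.
  have main : ∀ d₁ d₂ d₃ d₄ : ℂ, d₁ * d₄ - d₂ * d₃ ≠ 0 → (∀ x ∈ D, d₃ * x + d₄ ≠ 0) →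
      (∀ x ∈ D, deriv f x = (d₁ * d₄ - d₂ * d₃) / (d₃ * x + d₄) ^ 2) →
      ∃ c₁ c₂ c₃ c₄ : ℂ, c₁ * c₄ - c₂ * c₃ ≠ 0 ∧ (∀ x ∈ D, c₃ * x + c₄ ≠ 0) ∧
        Set.EqOn (fun x => (c₁ * x + c₂) / (c₃ * x + c₄)) f D := by
    intro d₁ d₂ d₃ d₄ hd hpole hder
    obtain ⟨s, hs⟩ := hD.exists_eq_add_of_deriv_eq hc.isPreconnected hf
      (g := fun x => (d₁ * x + d₂) / (d₃ * x + d₄))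
      (fun x hx => (hasDerivAt_mobius (hpole x hx)).differentiableAt.differentiableWithinAt)
      (fun x hx => by rw [hder x hx, (hasDerivAt_mobius (hpole x hx)).deriv])
    refine ⟨d₁ + s * d₃, d₂ + s * d₄, d₃, d₄, ?_, hpole, fun x hx => ?_⟩
    · convert hd using 1
      ring
    · rw [hs hx]
      simp only []
      rw [div_add' _ _ _ (hpole x hx)]
      congr 1
      ring
  have hq0 : ∀ x ∈ D, A * x ^ 2 + B * x + C ≠ 0 := fun x hx h0 => hκ (by
    rw [← hq x hx, h0, zero_mul])
  by_cases hA : A = 0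
  · have hB : B = 0 := by simpa [hA] using hdisc
    have hC : C ≠ 0 := by simpa [hA, hB] using hq0 x₀ hx₀
    refine main κ 0 0 C (by simpa using ⟨hκ, hC⟩) (by simpa using fun _ _ => hC) fun x hx => ?_
    have := hq x hx
    rw [hA, hB] at this
    rw [eq_div_iff (by simpa using hC)]
    linear_combination C * this
  · have hsq : ∀ x, 4 * A * (A * x ^ 2 + B * x + C) = (2 * A * x + B) ^ 2 := fun x => by
      linear_combination -hdisc
    have hpole : ∀ x ∈ D, 2 * A * x + B ≠ 0 := fun x hx h0 => hq0 x hx (by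
      have := hsq x
      rw [h0] at this
      simpa [hA] using this)
    -- The polynomial is `(2 * A * x + B) ^ 2 / (4 * A)`, so `-2 * κ / (2 * A * x + B)` is a
    -- primitive.
    refine main 0 (-(2 * κ)) (2 * A) B (by simpa using ⟨hκ, hA⟩) hpole fun x hx => ?_
    rw [eq_div_iff (pow_ne_zero _ (hpole x hx)), ← hsq]
    linear_combination 4 * A * hq x hx

/-- A Möbius transformation moves the two distinct roots (one of them possibly at infinity) of a
quadratic polynomial to zero and infinity. -/
theorem exists_mobius_of_distinct_roots {A B C : ℂ} (hdisc : B ^ 2 ≠ 4 * A * C) :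
    ∃ b₁ b₂ b₃ b₄ κ : ℂ, b₁ * b₄ - b₂ * b₃ ≠ 0 ∧ κ ≠ 0 ∧
      (∀ x, A * x ^ 2 + B * x + C ≠ 0 → b₁ - b₃ * x ≠ 0) ∧
      ∀ v, b₃ * v + b₄ ≠ 0 →
        (A * ((b₁ * v + b₂) / (b₃ * v + b₄)) ^ 2 + B * ((b₁ * v + b₂) / (b₃ * v + b₄)) + C) *
          (b₃ * v + b₄) ^ 2 = κ * v := by
  have hclear : ∀ {n d : ℂ}, d ≠ 0 → (A * (n / d) ^ 2 + B * (n / d) + C) * d ^ 2 =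
      A * n ^ 2 + B * n * d + C * d ^ 2 := by
    intro n d hd
    field_simp
  have h4 : (4 : ℂ) ≠ 0 := by norm_num
  by_cases hA : A = 0
  · have hB : B ≠ 0 := fun hB => hdisc (by rw [hA, hB]; ring)
    -- The other root is already at infinity; `v = B * x + C` moves the finite one to zero.
    refine ⟨1, -C, 0, B, B ^ 2, by simpa using hB, pow_ne_zero _ hB, by simp, fun v hv => ?_⟩
    rw [hclear hv, hA]
    ring
  · obtain ⟨s, hs⟩ := IsAlgClosed.exists_pow_nat_eq (B ^ 2 - 4 * A * C) (n := 2) (by norm_num)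
    have hs0 : s ≠ 0 := by
      rintro rfl
      apply hdisc
      linear_combination -hs
    -- The values at `v = 0` and `v = ∞` are the roots `(-B - s) / (2 * A)` and `(-B + s) / (2 *
    -- A)`.
    refine ⟨-B + s, B + s, 2 * A, -(2 * A), 4 * A * s ^ 2, ?_,
      mul_ne_zero (mul_ne_zero h4 hA) (pow_ne_zero _ hs0), ?_, fun v hv => ?_⟩
    · have : (-B + s) * -(2 * A) - (B + s) * (2 * A) = -(4 * A * s) := by ring
      rw [this]
      exact neg_ne_zero.2 (mul_ne_zero (mul_ne_zero h4 hA) hs0)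
    · intro x hx h0
      apply hx
      apply (mul_eq_zero.1 (_ : 4 * A * _ = 0)).resolve_left (mul_ne_zero h4 hA)
      linear_combination hs - (2 * A * x + B + s) * h0
    · rw [hclear hv]
      linear_combination (A * v ^ 2 - 2 * A * v + A) * hs

theorem equivLogForm_of_linearizable {Q : QuadFun} (hQ : IsMultilinear Q) (h : Linearizable Q)
    (hn : ¬ LinearizableByMobius Q) : EquivLogForm Q := by
  obtain ⟨f, D, a, b, c, d, e, p, h⟩ := h
  obtain ⟨α, rfl, rfl, rfl, rfl⟩ := exists_coeff a b c d
  obtain ⟨A, B, C, κ, hκ, -, hder⟩ := h.exists_quadratic hQ (i := (0, 0)) (k := (0, 1))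
    (l := (1, 0)) (by decide) (by decide) (by decide)
  by_cases hdisc : B ^ 2 = 4 * A * C
  · obtain ⟨c₁, c₂, c₃, c₄, hc, hpole, heq⟩ := exists_mobius_of_double_root h.isOpen h.isConnected
      h.differentiableOn hκ hder hdisc
    exact absurd ⟨c₁, c₂, c₃, c₄, hc, D, _, _, _, _, e, p, hpole, h.congr heq⟩ hn
  · obtain ⟨b₁, b₂, b₃, b₄, l, hb, hl, hpole, hroot⟩ := exists_mobius_of_distinct_roots hdisc
    obtain ⟨P, hP, hPQ⟩ := hQ.comp_affine b₁ b₂ b₃ b₄ id Function.bijective_id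
    have hPQ' : ∀ v : Vertex → ℂ, (∀ i, b₃ * v i + b₄ ≠ 0) → P v = 1 * (∏ i, (b₃ * v i + b₄)) *
        Q (fun i => (b₁ * v (id i) + b₂) / (b₃ * v (id i) + b₄)) := fun v hv => by
      rw [hPQ v hv, one_mul]
    have hq0 : ∀ x ∈ D, A * x ^ 2 + B * x + C ≠ 0 := fun x hx h0 => hκ (by
      rw [← hder x hx, h0, zero_mul])
    have hlin := h.mobius hQ hb one_ne_zero (Or.inl rfl) hPQ' fun x hx => hpole x (hq0 x hx)
    obtain ⟨A', B', S, hA', hB', hPS⟩ := LinearizesNear.eq_binomialForm hP hlin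
      (κ := κ * (b₁ * b₄ - b₂ * b₃) / l) (div_ne_zero (mul_ne_zero hκ hb) hl) fun x hx => by
        have hd := ((h.hasDerivAt hx.2).comp x (hasDerivAt_mobius hx.1)).deriv
        rw [Function.comp_def] at hd
        have h1 := hder _ hx.2
        have h2 := hroot x hx.1
        have h3 : (b₃ * x + b₄) ^ 2 ≠ 0 := pow_ne_zero _ hx.1
        rw [hd, eq_div_iff hl, mul_div_assoc', mul_div_assoc', div_mul_eq_mul_div, div_eq_iff h3]
        linear_combination (b₁ * b₄ - b₂ * b₃) * (b₃ * x + b₄) ^ 2 * h1 -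
          (b₁ * b₄ - b₂ * b₃) * deriv f ((b₁ * x + b₂) / (b₃ * x + b₄)) * h2
    exact EquivLogForm.of_mobiusEquiv hQ ⟨b₁, b₂, b₃, b₄, 1, hb, one_ne_zero, id, Or.inl rfl, hPQ'⟩
      (hPS ▸ equivLogForm_binomialForm hA' hB' S)

theorem exists_inversionForm {Q : QuadFun} (hQ : IsMultilinear Q) (h : LinearizableByMobius Q) :
    ∃ β γ δ ε : ℂ, β ≠ 0 ∧ γ ≠ 0 ∧ δ ≠ 0 ∧ (ε = 0 ∨ ε = 1) ∧
      MobiusEquiv Q (inversionForm β γ δ ε) := by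
  obtain ⟨c₁, c₂, c₃, c₄, hc, D, a, b, c, d, e, p, hD, h⟩ := h
  obtain ⟨α, rfl, rfl, rfl, rfl⟩ := exists_coeff a b c d
  -- The substituted map is the inverse of the linearizing one, so in the new coordinate the
  -- linearizing function is the identity.
  obtain ⟨P, hP, hPQ⟩ := hQ.comp_affine c₄ (-c₂) (-c₃) c₁ id Function.bijective_id
  have hc' : c₄ * c₁ - -c₂ * -c₃ ≠ 0 := by
    convert hc using 1
    ring
  have hPQ' : ∀ v : Vertex → ℂ, (∀ i, -c₃ * v i + c₁ ≠ 0) → P v = 1 * (∏ i, (-c₃ * v i + c₁)) *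
      Q (fun i => (c₄ * v (id i) + -c₂) / (-c₃ * v (id i) + c₁)) := fun v hv => by
    rw [hPQ v hv, one_mul]
  have hlin := h.mobius hQ hc' one_ne_zero (Or.inl rfl) hPQ' fun x hx => by
    rw [neg_mul, sub_neg_eq_add, add_comm]
    exact hD x hx
  have hα := hlin.coeff_ne hP
  have hlin' := hlin.congr (g := id) fun x hx => by
    have := mobius_inv_apply hc' hx.1
    rw [sub_neg_eq_add, neg_mul c₃ (_ / _), sub_neg_eq_add, add_comm c₄] at this
    exact this.symm
  obtain ⟨k, hk⟩ := hP.eq_const_mul_of_zero (isMultilinear_linearForm _ _ _ _ e) hlin'.solution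
    (fun i => by rw [← hP.partialDeriv_eq]; exact hlin'.regular i) hlin'.linear
  simp only [id] at hα hk
  have hk0 : k ≠ 0 := by
    rintro rfl
    simp only [zero_mul, linearForm_eq_sum α] at hk
    have h1 := hk 0
    have h2 := hk (Pi.single (0, 0) 1)
    simp [Pi.single_apply] at h1 h2
    exact hα (0, 0) (by linear_combination h2 - h1)
  -- In the substitution `u = μ / w` the scale `μ = e / α (0, 0)` makes a nonzero constant term
  -- equal to one after division by `α (0, 0) * μ`.
  obtain ⟨μ, ε, hμ, hε, hεe⟩ : ∃ μ ε : ℂ, μ ≠ 0 ∧ (ε = 0 ∨ ε = 1) ∧ e = α (0, 0) * μ * ε := by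
    by_cases he : e = 0
    · exact ⟨1, 0, one_ne_zero, Or.inl rfl, by simp [he]⟩
    · exact ⟨e / α (0, 0), 1, div_ne_zero he (hα _), Or.inr rfl, by
        rw [mul_div_cancel₀ _ (hα _), mul_one]⟩
  refine ⟨α (1, 0) / α (0, 0), α (0, 1) / α (0, 0), α (1, 1) / α (0, 0), ε,
    div_ne_zero (hα _) (hα _), div_ne_zero (hα _) (hα _), div_ne_zero (hα _) (hα _), hε,
    MobiusEquiv.trans hQ (isMultilinear_inversionForm _ _ _ _)
      ⟨_, _, _, _, _, hc', one_ne_zero, _, Or.inl rfl, hPQ'⟩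
      ⟨0, μ, 1, 0, k / (α (0, 0) * μ), by simpa using hμ,
        div_ne_zero hk0 (mul_ne_zero (hα _) hμ), id, Or.inl rfl, fun w hw => ?_⟩⟩
  have hw' : ∀ i, w i ≠ 0 := fun i => by simpa using hw i
  have hk' : ∀ u, P u = k⁻¹ * linearForm (α (0, 0)) (α (1, 0)) (α (0, 1)) (α (1, 1)) e u :=
    fun u => by rw [hk, inv_mul_cancel_left₀ hk0]
  have h0 := hα (0, 0)
  have h00 := hw' (0, 0)
  have h10 := hw' (1, 0)
  have h01 := hw' (0, 1)
  have h11 := hw' (1, 1)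
  rw [hk']
  simp only [linearForm, inversionForm, Fintype.prod_prod_type, Fin.prod_univ_two, id, zero_mul,
    zero_add, one_mul, add_zero, hεe]
  field_simp
  ring

/-- In each of the six forms the discriminant in `(u₁₀, u₀₁)` is a nonzero constant times `u₀₀ *
u₁₁`. -/
theorem not_linearizableByMobius_of_equivLogForm {Q : QuadFun} (hQ : IsMultilinear Q)
    (h : EquivLogForm Q) : ¬ LinearizableByMobius Q := by
  intro hm
  rcases h with h | h | h | h | ⟨θ, hθ, h | h⟩
  · refine not_linearizableByMobius_of_bidisc (logForm1_eq ▸ isMultilinear_binomialForm _ _ _)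
      (fun u x => ?_) (hm.of_mobiusEquiv hQ h)
    simp [bidisc, logForm1, Function.update]
  · refine not_linearizableByMobius_of_bidisc (logForm2_eq ▸ isMultilinear_binomialForm _ _ _)
      (fun u x => ?_) (hm.of_mobiusEquiv hQ h)
    simp [bidisc, logForm2, Function.update]
    ring
  · refine not_linearizableByMobius_of_bidisc (logForm3_eq ▸ isMultilinear_binomialForm _ _ _)
      (fun u x => ?_) (hm.of_mobiusEquiv hQ h)
    simp [bidisc, logForm3, Function.update]
  · refine not_linearizableByMobius_of_bidisc (logForm4_eq ▸ isMultilinear_binomialForm _ _ _)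
      (fun u x => ?_) (hm.of_mobiusEquiv hQ h)
    simp [bidisc, logForm4, Function.update]
    ring
  · refine not_linearizableByMobius_of_bidisc (logForm5_eq θ ▸ isMultilinear_binomialForm _ _ _)
      (fun u x => ?_) (hm.of_mobiusEquiv hQ h)
    simp [bidisc, logForm5, Function.update]
    ring
  · refine not_linearizableByMobius_of_bidisc (logForm6_eq θ ▸ isMultilinear_binomialForm _ _ _)
      (fun u x => ?_) (hm.of_mobiusEquiv hQ h)
    simp [bidisc, logForm6, Function.update]
    ring

/-! ### Explicit linearizations of the normal forms. -/

theorem forall_vertex {p : Vertex → Prop} :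
    (∀ i, p i) ↔ p (0, 0) ∧ p (1, 0) ∧ p (0, 1) ∧ p (1, 1) := by
  constructor
  · exact fun h => ⟨h _, h _, h _, h _⟩
  · rintro ⟨h1, h2, h3, h4⟩ ⟨i, j⟩
    fin_cases i <;> fin_cases j <;> assumption

theorem inversionForm_eq {w : Vertex → ℂ} (hw : ∀ i, w i ≠ 0) (β γ δ ε : ℂ) :
    inversionForm β γ δ ε w = w (0, 0) * w (1, 0) * w (0, 1) * w (1, 1) *
      linearForm 1 β γ δ ε (fun i => 1 / w i) := by
  have h00 := hw (0, 0)
  have h10 := hw (1, 0)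
  have h01 := hw (0, 1)
  have h11 := hw (1, 1)
  simp only [inversionForm, linearForm]
  field_simp
  ring

theorem inversionForm_eq_zero_iff {w : Vertex → ℂ} (hw : ∀ i, w i ≠ 0) (β γ δ ε : ℂ) :
    inversionForm β γ δ ε w = 0 ↔ linearForm 1 β γ δ ε (fun i => 1 / w i) = 0 := by
  rw [inversionForm_eq hw, mul_eq_zero, or_iff_right]
  exact mul_ne_zero (mul_ne_zero (mul_ne_zero (hw _) (hw _)) (hw _)) (hw _)

theorem linearizedByInversion_inversionForm {β γ δ ε : ℂ} (hβ : β ≠ 0) (hγ : γ ≠ 0) (hδ : δ ≠ 0) :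
    LinearizedByInversion (inversionForm β γ δ ε) 1 β γ δ ε := by
  have hQ := isMultilinear_inversionForm β γ δ ε
  refine ⟨fun w hw => inversionForm_eq_zero_iff hw β γ δ ε, ?_, fun p hp hp0 => ?_⟩
  · obtain ⟨s, hs⟩ := ({0, -γ - δ - ε} : Set ℂ).toFinite.infinite_compl.nonempty
    simp only [Set.mem_compl_iff, Set.mem_insert_iff, Set.mem_singleton_iff, not_or] at hs
    have hs' : -(s + γ + δ + ε) / β ≠ 0 := by
      refine div_ne_zero (neg_ne_zero.2 fun h => hs.2 ?_) hβ
      linear_combination h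
    set q : Vertex → ℂ := fun i => !![s⁻¹, 1; (-(s + γ + δ + ε) / β)⁻¹, 1] i.1 i.2 with hq
    have hq0 : ∀ i, q i ≠ 0 := by
      rw [forall_vertex]
      exact ⟨by simpa [hq] using hs.1, inv_ne_zero hs', by simp [hq],
        by simp [hq]⟩
    refine ⟨q, hq0, ?_⟩
    rw [inversionForm_eq_zero_iff hq0]
    have e1 : 1 / q (0, 0) = s := by simp [hq]
    have e2 : 1 / q (1, 0) = -(s + γ + δ + ε) / β := by
      rw [one_div]
      exact inv_inv _
    have e3 : 1 / q (0, 1) = 1 := by simp [hq]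
    have e4 : 1 / q (1, 1) = 1 := by simp [hq]
    rw [linearForm, e1, e2, e3, e4]
    field_simp
    ring
  · refine ⟨isOpen_compl_singleton, isConnected_compl_singleton_of_one_lt_rank (by simp) 0, ?_, ?_,
      Or.inl one_ne_zero, hp, hp0, ?_, ?_⟩
    · intro x hx
      have hx' : x ≠ 0 := hx
      simp only [one_div]
      exact (differentiableAt_inv hx').differentiableWithinAt
    · intro x hx
      have hx' : x ≠ 0 := hx
      simp [hx']
    · simp only [hQ.partialDeriv_eq]
      have hs : ∀ i, p i * vslope (inversionForm β γ δ ε) i p =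
          -inversionForm β γ δ ε (Function.update p i 0) := fun i => by
        rw [hQ.update_of_zero hp0]
        ring
      -- Setting one variable to zero leaves a single monomial with nonzero coefficient.
      have hne : ∀ i, inversionForm β γ δ ε (Function.update p i 0) ≠ 0 := by
        have h00 := hp (0, 0)
        have h10 := hp (1, 0)
        have h01 := hp (0, 1)
        have h11 := hp (1, 1)
        rw [forall_vertex]
        refine ⟨?_, ?_, ?_, ?_⟩ <;>
          simp [inversionForm, Function.update, h00, h10, h01, h11, hβ, hγ, hδ]
      intro i h0
      have := hs i
      rw [h0, mul_zero] at this
      exact hne i (neg_eq_zero.1 this.symm)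
    · have h1 : ∀ᶠ u in 𝓝 p, ∀ i, u i ≠ 0 := Filter.eventually_all.2 fun i =>
        (continuous_apply i).continuousAt.eventually_ne (hp i)
      filter_upwards [h1] with u hu hu0
      exact (inversionForm_eq_zero_iff hu β γ δ ε).1 hu0

theorem linearizableByMobius_inversionForm {β γ δ ε : ℂ} (hβ : β ≠ 0) (hγ : γ ≠ 0) (hδ : δ ≠ 0) :
    LinearizableByMobius (inversionForm β γ δ ε) := by
  obtain ⟨-, ⟨p, hp, hp0⟩, h⟩ := linearizedByInversion_inversionForm (ε := ε) hβ hγ hδ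
  exact ⟨0, 1, 1, 0, by simp, {0}ᶜ, 1, β, γ, δ, ε, p, by simp, by simpa using h p hp hp0⟩

/-- An equation `∏ w i ^ n i = θ` is linearized by the logarithm. -/
theorem linearizedByLog_of_zpow {Q : QuadFun} (hQ : IsMultilinear Q) {n : Vertex → ℤ} {θ : ℂ}
    (hn : n (0, 0) ≠ 0) (hθ : θ ≠ 0)
    (hzero : ∀ w : Vertex → ℂ, (∀ i, w i ≠ 0) → (Q w = 0 ↔ ∏ i, w i ^ n i = θ))
    (hex : ∃ p : Vertex → ℂ, (∀ i, p i ∈ Complex.slitPlane) ∧ Q p = 0)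
    (hreg : ∀ w : Vertex → ℂ, (∀ i, w i ≠ 0) → ∀ i, vslope Q i w ≠ 0) :
    LinearizedByLog Q (n (0, 0)) (n (1, 0)) (n (0, 1)) (n (1, 1)) (Complex.log θ) := by
  have hiff : ∀ w : Vertex → ℂ, (∀ i, w i ≠ 0) → (Q w = 0 ↔ ∃ z : ℤ,
      linearForm (n (0, 0)) (n (1, 0)) (n (0, 1)) (n (1, 1)) 0 (fun i => Complex.log (w i)) =
        Complex.log θ + 2 * Real.pi * Complex.I * z) := by
    intro w hw
    rw [hzero w hw, linearForm_eq_sum fun i => (n i : ℂ), add_zero]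
    have hexp : Complex.exp (∑ i, (n i : ℂ) * Complex.log (w i)) = ∏ i, w i ^ n i := by
      rw [Complex.exp_sum]
      refine Finset.prod_congr rfl fun i _ => ?_
      rw [Complex.exp_int_mul, Complex.exp_log (hw i)]
    rw [← hexp]
    nth_rw 1 [← Complex.exp_log hθ]
    rw [Complex.exp_eq_exp_iff_exists_int]
    refine exists_congr fun z => ?_
    rw [mul_comm (z : ℂ)]
  refine ⟨hiff, hex, fun p hp hp0 => ?_⟩
  have hp' : ∀ i, p i ≠ 0 := fun i => Complex.slitPlane_ne_zero (hp i)
  obtain ⟨z, hz⟩ := (hiff p hp').1 hp0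
  have hlf : ∀ κ : ℂ, ∀ u : Vertex → ℂ,
      linearForm (n (0, 0)) (n (1, 0)) (n (0, 1)) (n (1, 1)) (-κ) u =
        linearForm (n (0, 0)) (n (1, 0)) (n (0, 1)) (n (1, 1)) 0 u - κ := fun κ u => by
    simp only [linearForm]
    ring
  refine ⟨z, Complex.isOpen_slitPlane, ?_, fun x hx =>
    (Complex.differentiableAt_log hx).differentiableWithinAt, fun x hx => ?_,
    Or.inl (by exact_mod_cast hn), hp, hp0, fun i => ?_, ?_⟩
  · exact (Complex.starConvex_one_slitPlane.isPathConnected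
      Complex.one_mem_slitPlane).isConnected
  · rw [(Complex.hasDerivAt_log hx).deriv]
    exact inv_ne_zero (Complex.slitPlane_ne_zero hx)
  · rw [hQ.partialDeriv_eq]
    exact hreg p hp' i
  · have h1 : ∀ᶠ u in 𝓝 p, ∀ i, u i ≠ 0 := Filter.eventually_all.2 fun i =>
      (continuous_apply i).continuousAt.eventually_ne (hp' i)
    have hcont : ContinuousAt (fun u : Vertex → ℂ =>
        linearForm (n (0, 0)) (n (1, 0)) (n (0, 1)) (n (1, 1)) 0
          (fun i => Complex.log (u i))) p := by
      have hl : ∀ i, ContinuousAt (fun u : Vertex → ℂ => Complex.log (u i)) p := fun i =>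
        (continuous_apply i).continuousAt.clog (hp i)
      simp only [linearForm]
      exact ((((continuousAt_const.mul (hl _)).add (continuousAt_const.mul (hl _))).add
        (continuousAt_const.mul (hl _))).add (continuousAt_const.mul (hl _))).add
          continuousAt_const
    have h2 := hcont.eventually (Metric.ball_mem_nhds _ (by positivity : 0 < 2 * Real.pi))
    filter_upwards [h1, h2] with u hu1 hu2 hu0
    obtain ⟨y, hy⟩ := (hiff u hu1).1 hu0
    -- Values for different integers are at least `2π` apart, so continuity of the logarithms keeps
    -- the integer fixed near `p`.
    have hyz : y = z := by
      rw [hy, hz, dist_eq_norm, add_sub_add_left_eq_sub, ← mul_sub, norm_mul,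
        ← Int.cast_sub, Complex.norm_intCast] at hu2
      have h3 : ‖2 * (Real.pi : ℂ) * Complex.I‖ = 2 * Real.pi := by
        simp [abs_of_pos Real.pi_pos]
      rw [h3, mul_lt_iff_lt_one_right (by positivity)] at hu2
      have h4 : |y - z| < 1 := by exact_mod_cast hu2
      exact sub_eq_zero.1 (Int.abs_lt_one_iff.1 h4)
    rw [hlf, hy, hyz, sub_self]

theorem linearizable_of_linearizedByLog {Q : QuadFun} {a b c d κ : ℂ}
    (h : LinearizedByLog Q a b c d κ) : Linearizable Q := by
  obtain ⟨-, ⟨p, hp, hp0⟩, h⟩ := h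
  obtain ⟨z, hz⟩ := h p hp hp0
  exact ⟨_, _, _, _, _, _, _, _, hz⟩

theorem linearizedByLog_logForm1 : LinearizedByLog logForm1 1 1 1 1 0 := by
  have := linearizedByLog_of_zpow (logForm1_eq ▸ isMultilinear_binomialForm _ _ _)
    (n := fun _ => 1) (θ := 1) one_ne_zero one_ne_zero (Q := logForm1) (fun w hw => by
      simp [logForm1, Fintype.prod_prod_type, Fin.prod_univ_two, sub_eq_zero]
      ring_nf) ⟨fun _ => 1, by simp, by simp [logForm1]⟩ (fun w hw => by
      rw [forall_vertex]
      simp [vslope, logForm1, Function.update, hw])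
  simpa using this

theorem linearizedByLog_logForm2 : LinearizedByLog logForm2 (-1) 1 1 1 0 := by
  have := linearizedByLog_of_zpow (logForm2_eq ▸ isMultilinear_binomialForm _ _ _)
    (n := fun i => if i = (0, 0) then -1 else 1) (θ := 1) (by simp) one_ne_zero (Q := logForm2)
    (fun w hw => by
      have := hw (0, 0)
      simp [logForm2, Fintype.prod_prod_type, Fin.prod_univ_two, sub_eq_zero]
      field_simp
      rw [eq_comm]) ⟨fun _ => 1, by simp, by simp [logForm2]⟩ (fun w hw => by
      rw [forall_vertex]
      simp [vslope, logForm2, Function.update, hw])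
  simpa using this

theorem linearizedByLog_logForm3 : LinearizedByLog logForm3 1 (-1) 1 1 0 := by
  have := linearizedByLog_of_zpow (logForm3_eq ▸ isMultilinear_binomialForm _ _ _)
    (n := fun i => if i = (1, 0) then -1 else 1) (θ := 1) (by simp) one_ne_zero (Q := logForm3)
    (fun w hw => by
      have := hw (1, 0)
      simp [logForm3, Fintype.prod_prod_type, Fin.prod_univ_two, sub_eq_zero]
      field_simp
      rw [eq_comm]) ⟨fun _ => 1, by simp, by simp [logForm3]⟩ (fun w hw => by
      rw [forall_vertex]
      simp [vslope, logForm3, Function.update, hw])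
  simpa using this

theorem linearizedByLog_logForm4 : LinearizedByLog logForm4 (-1) (-1) (-1) 1 0 := by
  have := linearizedByLog_of_zpow (logForm4_eq ▸ isMultilinear_binomialForm _ _ _)
    (n := fun i => if i = (1, 1) then 1 else -1) (θ := 1) (by simp) one_ne_zero (Q := logForm4)
    (fun w hw => by
      have h1 := hw (0, 0)
      have h2 := hw (1, 0)
      have h3 := hw (0, 1)
      simp [logForm4, Fintype.prod_prod_type, Fin.prod_univ_two, sub_eq_zero]
      field_simp) ⟨fun _ => 1, by simp, by simp [logForm4]⟩ (fun w hw => by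
      rw [forall_vertex]
      simp [vslope, logForm4, Function.update, hw])
  simpa using this

/-- Only a negative real `θ` needs an argument: it is split as `I * (-I * θ)`. This supplies
solutions of the forms with parameter `θ` off the branch cut. -/
theorem exists_mul_eq_slitPlane {θ : ℂ} (hθ : θ ≠ 0) :
    ∃ x ∈ Complex.slitPlane, ∃ y ∈ Complex.slitPlane, x * y = θ := by
  by_cases h : θ ∈ Complex.slitPlane
  · exact ⟨θ, h, 1, Complex.one_mem_slitPlane, mul_one θ⟩
  · rw [Complex.mem_slitPlane_iff, not_or, not_lt, not_not] at h
    refine ⟨Complex.I, by simp [Complex.mem_slitPlane_iff], -Complex.I * θ, ?_, ?_⟩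
    · refine Complex.mem_slitPlane_iff.2 (Or.inr ?_)
      simp only [neg_mul, Complex.neg_im, Complex.I_mul_im, ne_eq, neg_eq_zero]
      exact fun hre => hθ (Complex.ext hre h.2)
    · linear_combination -θ * Complex.I_mul_I

theorem linearizedByLog_logForm5 {θ : ℂ} (hθ : θ ≠ 0) :
    LinearizedByLog (logForm5 θ) (-1) (-1) 1 1 (Complex.log θ) := by
  obtain ⟨x, hx, y, hy, hxy⟩ := exists_mul_eq_slitPlane hθ
  have := linearizedByLog_of_zpow (logForm5_eq θ ▸ isMultilinear_binomialForm _ _ _)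
    (n := fun i => if i.2 = 0 then -1 else 1) (θ := θ) (by simp) hθ (Q := logForm5 θ)
    (fun w hw => by
      have h1 := hw (0, 0)
      have h2 := hw (1, 0)
      simp [logForm5, Fintype.prod_prod_type, Fin.prod_univ_two, sub_eq_zero]
      field_simp)
    ⟨fun i => !![1, x; 1, y] i.1 i.2, by
      rw [forall_vertex]
      simp [hx, hy], by simp [logForm5, hxy]⟩ (fun w hw => by
      rw [forall_vertex]
      simp [vslope, logForm5, Function.update, hw, hθ])
  simpa using this

theorem linearizedByLog_logForm6 {θ : ℂ} (hθ : θ ≠ 0) :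
    LinearizedByLog (logForm6 θ) 1 (-1) (-1) 1 (Complex.log θ) := by
  obtain ⟨x, hx, y, hy, hxy⟩ := exists_mul_eq_slitPlane hθ
  have := linearizedByLog_of_zpow (logForm6_eq θ ▸ isMultilinear_binomialForm _ _ _)
    (n := fun i => if i.1 = i.2 then 1 else -1) (θ := θ) (by simp) hθ (Q := logForm6 θ)
    (fun w hw => by
      have h1 := hw (0, 1)
      have h2 := hw (1, 0)
      simp [logForm6, Fintype.prod_prod_type, Fin.prod_univ_two, sub_eq_zero]
      field_simp)
    ⟨fun i => !![x, 1; 1, y] i.1 i.2, by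
      rw [forall_vertex]
      simp [hx, hy], by simp [logForm6, hxy]⟩ (fun w hw => by
      rw [forall_vertex]
      simp [vslope, logForm6, Function.update, hw, hθ])
  simpa using this

theorem linearizable_of_equivLogForm {Q : QuadFun} (h : EquivLogForm Q) : Linearizable Q := by
  rcases h with h | h | h | h | ⟨θ, hθ, h | h⟩
  · exact (linearizable_of_linearizedByLog linearizedByLog_logForm1).of_mobiusEquiv
      (logForm1_eq ▸ isMultilinear_binomialForm _ _ _) h.symm
  · exact (linearizable_of_linearizedByLog linearizedByLog_logForm2).of_mobiusEquiv
      (logForm2_eq ▸ isMultilinear_binomialForm _ _ _) h.symm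
  · exact (linearizable_of_linearizedByLog linearizedByLog_logForm3).of_mobiusEquiv
      (logForm3_eq ▸ isMultilinear_binomialForm _ _ _) h.symm
  · exact (linearizable_of_linearizedByLog linearizedByLog_logForm4).of_mobiusEquiv
      (logForm4_eq ▸ isMultilinear_binomialForm _ _ _) h.symm
  · exact (linearizable_of_linearizedByLog (linearizedByLog_logForm5 hθ)).of_mobiusEquiv
      (logForm5_eq θ ▸ isMultilinear_binomialForm _ _ _) h.symm
  · exact (linearizable_of_linearizedByLog (linearizedByLog_logForm6 hθ)).of_mobiusEquiv
      (logForm6_eq θ ▸ isMultilinear_binomialForm _ _ _) h.symm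

theorem theorem1 :
    -- the multilinear equations linearizable by a Möbius transformation
    (∀ Q : QuadFun, IsMultilinear Q →
      (LinearizableByMobius Q ↔
        ∃ β γ δ ε : ℂ, β ≠ 0 ∧ γ ≠ 0 ∧ δ ≠ 0 ∧ (ε = 0 ∨ ε = 1) ∧
          MobiusEquiv Q (inversionForm β γ δ ε))) ∧
    -- the other linearizable multilinear equations
    (∀ Q : QuadFun, IsMultilinear Q →
      ((Linearizable Q ∧ ¬ LinearizableByMobius Q) ↔
        (MobiusEquiv Q logForm1 ∨ MobiusEquiv Q logForm2 ∨ MobiusEquiv Q logForm3 ∨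
          MobiusEquiv Q logForm4 ∨
          ∃ θ : ℂ, θ ≠ 0 ∧ (MobiusEquiv Q (logForm5 θ) ∨ MobiusEquiv Q (logForm6 θ))))) ∧
    -- the linearizations of the normal forms
    (∀ β γ δ ε : ℂ, β ≠ 0 → γ ≠ 0 → δ ≠ 0 → (ε = 0 ∨ ε = 1) →
      LinearizedByInversion (inversionForm β γ δ ε) 1 β γ δ ε) ∧
    LinearizedByLog logForm1 1 1 1 1 0 ∧
    LinearizedByLog logForm2 (-1) 1 1 1 0 ∧
    LinearizedByLog logForm3 1 (-1) 1 1 0 ∧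
    LinearizedByLog logForm4 (-1) (-1) (-1) 1 0 ∧
    (∀ θ : ℂ, θ ≠ 0 → LinearizedByLog (logForm5 θ) (-1) (-1) 1 1 (Complex.log θ)) ∧
    (∀ θ : ℂ, θ ≠ 0 → LinearizedByLog (logForm6 θ) 1 (-1) (-1) 1 (Complex.log θ)) := by
  refine ⟨fun Q hQ => ⟨exists_inversionForm hQ, ?_⟩, fun Q hQ => ⟨?_, fun h => ?_⟩,
    fun β γ δ ε hβ hγ hδ _ => linearizedByInversion_inversionForm hβ hγ hδ,
    linearizedByLog_logForm1, linearizedByLog_logForm2, linearizedByLog_logForm3,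
    linearizedByLog_logForm4, fun θ hθ => linearizedByLog_logForm5 hθ,
    fun θ hθ => linearizedByLog_logForm6 hθ⟩
  · rintro ⟨β, γ, δ, ε, hβ, hγ, hδ, -, h⟩
    exact (linearizableByMobius_inversionForm hβ hγ hδ).of_mobiusEquiv
      (isMultilinear_inversionForm β γ δ ε) h.symm
  · exact fun h => equivLogForm_of_linearizable hQ h.1 h.2
  · exact ⟨linearizable_of_equivLogForm h, not_linearizableByMobius_of_equivLogForm hQ h⟩
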